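/- Let $\mathfrak h_{\mathbb R}$ be a finite-dimensional real Euclidean space, $W\subset O(\mathfrak h_{\mathbb R})$ a finite reflection group, $\mathcal H$ the arrangement of its reflection hyperplanes, $\mathcal C$ the set of faces of $\mathcal H$ (ordered by inclusion of closures), $C^+\in\mathcal C$ a chosen dominant chamber, $\mathfrak h=\mathfrak h_{\mathbb R}\otimes\mathbb C=\mathfrak h_{\mathbb R}\oplus i\mathfrak h_{\mathbb R}$, and $p:\mathfrak h\to W\backslash\mathfrak h$ the projection. Define the following families of subsets (strata) of $W\backslash\mathfrak h$. * $\mathcal S^{(0)}$: the sets $p(L^\circ)$, where $L$ runs over the flats (intersections of hyperplanes of $\mathcal H$, including $\mathfrak h_{\mathbb R}$ itself) and $L^\circ$ is the generic part of $L_{\mathbb C}$, i.e. the complement in $L_{\mathbb C}$ of the $H_{\mathbb C}$ for $H\in\mathcal H$, $H\not\supset L$. * $\mathcal S^{(1)}$ (the Fox–Neuwirth–Fuchs cells): the sets $p([C,D])$ for $C,D\in\mathcal C$ with $C\le D$, where $[C,D]$ is the set of $x+iy$ with $y\in C$ and $x\in D+\mathrm{Lin}_{\mathbb R}(C)$. *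 $\mathcal S^{\Im}$: the preimages, under the map $W\backslash\mathfrak h\to W\backslash\mathfrak h_{\mathbb R}$ induced by $x+iy\mapsto y$, of the images in $W\backslash\mathfrak h_{\mathbb R}$ of the faces $C\in\mathcal C$ with $C\le C^+$. Let $\tau:W\backslash\mathfrak h\to W\backslash\mathfrak h$ be the involution induced by $x+iy\mapsto y+ix$. For partitions $\mathcal S,\mathcal T$ of a space $X$, say that $\mathcal S$ refines $\mathcal T$ if each stratum of $\mathcal T$ is a union of strata of $\mathcal S$; let $\mathcal S\wedge\mathcal T$ be the family of connected components of the intersections $A\cap B$ ($A\in\mathcal S$, $B\in\mathcal T$), and let $\mathcal S\vee\mathcal T$ be the family of classes of the equivalence relation generated by the relation "$x$ and $y$ lie in a common stratum of $\mathcal S$ or in a common stratum of $\mathcal T$". A sheaf of vector spaces over a field $\mathbf k$ is $\mathcal S$-constructible if its restriction to each stratum of $\mathcal S$ is locally constant of finite rank. Then $\mathcal S^{\Im}$, $\mathcal S^{(1)}$ and $\mathcal S^{(0)}$ are finite partitions of $W\backslash\mathfrak h$, and: (a) $\mathcal S^{(1)}=\mathcal S^{\Im}\wedge\mathcal S^{(0)}$.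 In particular, $\mathcal S^{(1)}$ refines both $\mathcal S^{\Im}$ and $\mathcal S^{(0)}$. (b) $\mathcal S^{(0)}=\mathcal S^{(1)}\vee\tau(\mathcal S^{(1)})$. In particular, for every field $\mathbf k$, any sheaf of $\mathbf k$-vector spaces on $W\backslash\mathfrak h$ which is both $\mathcal S^{(1)}$-constructible and $\tau(\mathcal S^{(1)})$-constructible is $\mathcal S^{(0)}$-constructible. -/

import Mathlib

open CategoryTheory TopologicalSpace

universe u

namespace FoxNeuwirthFuchs

section ReflectionGroup

variable {V : Type u} [NormedAddCommGroup V] [InnerProductSpace ℝ V]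

/-- The nonzero normal vectors of the reflection hyperplanes of `W`: those `v ≠ 0` for which the
orthogonal reflection in the hyperplane `v^⊥` belongs to `W`. -/
def normals (W : Subgroup (V ≃ₗᵢ[ℝ] V)) : Set V :=
  {v | v ≠ 0 ∧ (ℝ ∙ v)ᗮ.reflection ∈ W}

/-- `W` is a finite reflection group: it is finite and generated by the orthogonal reflections
in hyperplanes that it contains. -/
def IsFiniteReflectionGroup (W : Subgroup (V ≃ₗᵢ[ℝ] V)) : Prop :=
  Finite W ∧ W = Subgroup.closure ((fun v : V => (ℝ ∙ v)ᗮ.reflection) '' normals W)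

/-- The arrangement of reflection hyperplanes of `W`. -/
def hyperplanes (W : Subgroup (V ≃ₗᵢ[ℝ] V)) : Set (Submodule ℝ V) :=
  (fun v : V => (ℝ ∙ v)ᗮ) '' normals W

/-- The face of the arrangement that contains `y`: the points which lie on the same side of
(or on) every hyperplane as `y` does. -/
noncomputable def faceOf (W : Subgroup (V ≃ₗᵢ[ℝ] V)) (y : V) : Set V :=
  {x | ∀ v ∈ normals W, SignType.sign (inner ℝ v x) = SignType.sign (inner ℝ v y)}

/-- The Coxeter complex: the set of all faces of the arrangement. The order on faces is
inclusion of closures, so `C ≤ D` means `C ⊆ closure D`. -/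
noncomputable def faces (W : Subgroup (V ≃ₗᵢ[ℝ] V)) : Set (Set V) :=
  Set.range (faceOf W)

/-- A chamber is a connected component of the complement of the union of the hyperplanes. -/
def IsChamber (W : Subgroup (V ≃ₗᵢ[ℝ] V)) (C : Set V) : Prop :=
  ∃ x ∈ (⋃ H ∈ hyperplanes W, (H : Set V))ᶜ,
    C = connectedComponentIn (⋃ H ∈ hyperplanes W, (H : Set V))ᶜ x

/-- The flats of the arrangement: all intersections of hyperplanes, the empty one included. -/
def flats (W : Subgroup (V ≃ₗᵢ[ℝ] V)) : Set (Submodule ℝ V) :=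
  {L | ∃ A ⊆ hyperplanes W, L = sInf A}

/-- The complexification `V ⊗ ℂ = V ⊕ i V` of `V`, as a topological space with an action of the
isometries of `V`. The pair `(x, y)` stands for `x + i y`. -/
abbrev Complexified (V : Type u) : Type u := V × V

/-- The orbit relation of `W` on `V`. -/
def realSetoid (W : Subgroup (V ≃ₗᵢ[ℝ] V)) : Setoid V where
  r x x' := ∃ w ∈ W, w x = x'
  iseqv :=
    { refl := fun x => ⟨1, W.one_mem, rfl⟩
      symm := by
        rintro x x' ⟨w, hw, rfl⟩
        exact ⟨w⁻¹, W.inv_mem hw, w.symm_apply_apply x⟩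
      trans := by
        rintro x x' x'' ⟨w, hw, rfl⟩ ⟨w', hw', rfl⟩
        exact ⟨w' * w, W.mul_mem hw' hw, rfl⟩ }

/-- The orbit relation of `W` on the complexification, where `w (x + i y) = w x + i w y`. -/
def complexSetoid (W : Subgroup (V ≃ₗᵢ[ℝ] V)) : Setoid (Complexified V) where
  r z z' := ∃ w ∈ W, w z.1 = z'.1 ∧ w z.2 = z'.2
  iseqv :=
    { refl := fun x => ⟨1, W.one_mem, rfl, rfl⟩
      symm := by
        rintro ⟨x, y⟩ ⟨x', y'⟩ ⟨w, hw, rfl, rfl⟩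
        exact ⟨w⁻¹, W.inv_mem hw, w.symm_apply_apply x, w.symm_apply_apply y⟩
      trans := by
        rintro ⟨x, y⟩ ⟨x', y'⟩ ⟨x'', y''⟩ ⟨w, hw, rfl, rfl⟩ ⟨w', hw', rfl, rfl⟩
        exact ⟨w' * w, W.mul_mem hw' hw, rfl, rfl⟩ }

/-- The real quotient `W \ V`. -/
abbrev RealQuotient (W : Subgroup (V ≃ₗᵢ[ℝ] V)) : Type u := Quotient (realSetoid W)

/-- The quotient `W \ (V ⊗ ℂ)`, with the quotient topology. -/
abbrev ComplexQuotient (W : Subgroup (V ≃ₗᵢ[ℝ] V)) : Type u := Quotient (complexSetoid W)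

/-- The projection `V → W \ V`. -/
def realProj (W : Subgroup (V ≃ₗᵢ[ℝ] V)) : V → RealQuotient W :=
  Quotient.mk (realSetoid W)

/-- The projection `V ⊗ ℂ → W \ (V ⊗ ℂ)`. -/
def proj (W : Subgroup (V ≃ₗᵢ[ℝ] V)) : Complexified V → ComplexQuotient W :=
  Quotient.mk (complexSetoid W)

/-- The map `W \ (V ⊗ ℂ) → W \ V` induced by the imaginary part `x + i y ↦ y`. -/
def imMap (W : Subgroup (V ≃ₗᵢ[ℝ] V)) : ComplexQuotient W → RealQuotient W :=
  Quotient.map Prod.snd (by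
    rintro z z' ⟨w, hw, _, h⟩
    exact ⟨w, hw, h⟩)

/-- The involution of `W \ (V ⊗ ℂ)` induced by `x + i y ↦ y + i x`. -/
def tau (W : Subgroup (V ≃ₗᵢ[ℝ] V)) : ComplexQuotient W → ComplexQuotient W :=
  Quotient.map Prod.swap (by
    rintro z z' ⟨w, hw, h, h'⟩
    exact ⟨w, hw, h', h⟩)

/-- The generic part of the complexification of the flat `L`: the points of `L ⊗ ℂ` which lie
in no complexified hyperplane `H ⊗ ℂ` other than those with `L ≤ H`. -/
def genericPart (W : Subgroup (V ≃ₗᵢ[ℝ] V)) (L : Submodule ℝ V) : Set (Complexified V) :=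
  {z | (z.1 ∈ L ∧ z.2 ∈ L) ∧ ∀ H ∈ hyperplanes W, ¬ L ≤ H → ¬ (z.1 ∈ H ∧ z.2 ∈ H)}

/-- The strata of `𝒮⁽⁰⁾`: the images of the generic parts of the complexified flats. -/
def S0 (W : Subgroup (V ≃ₗᵢ[ℝ] V)) : Set (Set (ComplexQuotient W)) :=
  {X | ∃ L ∈ flats W, X = proj W '' genericPart W L}

/-- The cell `[C, D]` of `V ⊗ ℂ`: all `x + i y` such that `y ∈ C`, and `x` is congruent to an
element of `D` modulo the linear span of `C`. -/
def cell (C D : Set V) : Set (Complexified V) :=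
  {z | z.2 ∈ C ∧ ∃ d ∈ D, z.1 - d ∈ Submodule.span ℝ C}

/-- The strata of `𝒮⁽¹⁾`, that is the Fox-Neuwirth-Fuchs cells: the images of the cells
`[C, D]`, where `(C, D)` runs over the pairs of faces with `C ≤ D`. -/
noncomputable def S1 (W : Subgroup (V ≃ₗᵢ[ℝ] V)) : Set (Set (ComplexQuotient W)) :=
  {X | ∃ C ∈ faces W, ∃ D ∈ faces W, C ⊆ closure D ∧ X = proj W '' cell C D}

/-- The strata of the imaginary decomposition, for the dominant chamber `Cplus`: the preimages
under `imMap` of the sets `K_I`, the images in `W \ V` of the faces of `Cplus`. -/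
noncomputable def SIm (W : Subgroup (V ≃ₗᵢ[ℝ] V)) (Cplus : Set V) :
    Set (Set (ComplexQuotient W)) :=
  {X | ∃ C ∈ faces W, C ⊆ closure Cplus ∧ X = imMap W ⁻¹' (realProj W '' C)}

end ReflectionGroup

section Partitions

variable {X : Type u}

/-- A finite family of nonempty, pairwise disjoint subsets with union `X`. -/
def IsFinitePartition (S : Set (Set X)) : Prop :=
  S.Finite ∧ Setoid.IsPartition S

/-- `S` refines `T`: each stratum of `T` is a union of strata of `S`. -/
def Refines (S T : Set (Set X)) : Prop :=
  ∀ B ∈ T, ∃ A ⊆ S, B = ⋃₀ A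

/-- The maximal common refinement `S ∧ T`: the connected components of the intersections of a
stratum of `S` with a stratum of `T`. -/
def wedge [TopologicalSpace X] (S T : Set (Set X)) : Set (Set X) :=
  {Z | ∃ A ∈ S, ∃ B ∈ T, ∃ x ∈ A ∩ B, Z = connectedComponentIn (A ∩ B) x}

/-- The maximal common coarsening `S ∨ T`: the classes of the equivalence relation generated by
the relation of lying in the same stratum of `S` or in the same stratum of `T`. -/
def vee (S T : Set (Set X)) : Set (Set X) :=
  {Z | ∃ x, Z = {y | Relation.EqvGen
    (fun a b => (∃ A ∈ S, a ∈ A ∧ b ∈ A) ∨ (∃ B ∈ T, a ∈ B ∧ b ∈ B)) x y}}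

/-- The image of a family of subsets of `X` under a map. -/
def imageFamily {Y : Type u} (f : X → Y) (S : Set (Set X)) : Set (Set Y) :=
  {B | ∃ A ∈ S, B = f '' A}

end Partitions

section Sheaves

variable {k : Type u} [Field k]

/-- The restriction (inverse image) of a sheaf of `k`-vector spaces to a subset with the
subspace topology. -/
noncomputable def restrict {X : TopCat.{u}} (F : TopCat.Sheaf (ModuleCat.{u} k) X) (A : Set X) :
    TopCat.Sheaf (ModuleCat.{u} k) (TopCat.of A) :=
  (TopCat.Sheaf.pullback (ModuleCat.{u} k)
    (TopCat.ofHom ⟨Subtype.val, continuous_subtype_val⟩ : TopCat.of A ⟶ X)).obj F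

/-- Every point has an open neighbourhood on which the sheaf is isomorphic to the constant sheaf
of a finite-dimensional `k`-vector space. -/
def IsLocallyConstantOfFiniteRank {X : TopCat.{u}}
    (F : TopCat.Sheaf (ModuleCat.{u} k) X) : Prop :=
  ∀ x : X, ∃ U : Set X, IsOpen U ∧ x ∈ U ∧ ∃ M : ModuleCat.{u} k, Module.Finite k M ∧
    Nonempty (restrict F U ≅
      (constantSheaf (Opens.grothendieckTopology (TopCat.of U)) (ModuleCat.{u} k)).obj M)

/-- `F` is `S`-constructible: its restriction to each stratum of `S` is locally constant of
finite rank. -/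
def IsConstructible {X : TopCat.{u}} (S : Set (Set X))
    (F : TopCat.Sheaf (ModuleCat.{u} k) X) : Prop :=
  ∀ A ∈ S, IsLocallyConstantOfFiniteRank (restrict F A)

end Sheaves

end FoxNeuwirthFuchs

/-! Write z = x + iy. All the strata are images in the quotient of classes given by sign data of the
normals: the signs at y (`imClass`); the signs at y together with, on the hyperplanes through y, the
signs at x (`cellClass`); or only the set of hyperplanes that contain both x and y (`flatClass`).
For the cells this rests on `exists_sign_add_smul`: for large s, x + s y takes the side of y
wherever y lies off the hyperplane. Since W permutes the finitely many unit normals, finiteness, the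
partition property and the refinements follow formally.

For (a), consider the intersection of an imaginary stratum with a flat stratum. A limit of points of
a cell keeps the vanishing of normals and can only gain zeros. The number of unit normals vanishing
at y, and the number vanishing at both x and y, are constant on the respective strata, so no zero is
gained and the cells are relatively closed in the intersection (`mem_cellClass_of_mem_closure`).
They are finitely many, disjoint, and connected as images of convex sets, hence they are the
components.

For the equality in (b), let g be generic in the smallest flat through z. Then (x, y) ~ (x + s y, y)
~ (x + s y, g) ~ (g, g), with moves alternately inside a cell and inside a τ-cell. So all points of
a flat stratum are equivalent; conversely both kinds of cell lie inside flat strata.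

The sheaf statement needs a local version. Near z₀ a flat stratum is a box, a product of two balls
in the flat. That the projection is injective on the box uses that point stabilizers in W are
generated by reflections (`map_eq_of_mem_flatOf`). Every point of the box is reached from z₀ by a
horizontal path in one cell followed by a vertical path in one τ-cell, and F is locally constant
along each. Different vertical paths may lie in different τ-cells, so F is not yet known to be
locally constant across them. But transport along a continuous family of paths yields a section as
soon as its values at the starting points form one (`isSectionAt_of_paths`). Hence each germ extends
uniquely over the box, and F is constant there. -/

namespace FoxNeuwirthFuchs

/-! ### Finite reflection groups: simple systems, exchange, fundamental domain. -/

section SimpleSystems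

open scoped NNReal

variable {V : Type u} [NormedAddCommGroup V] [InnerProductSpace ℝ V]
  {W : Subgroup (V ≃ₗᵢ[ℝ] V)} {x₀ : V}

/-- The orthogonal reflection in the hyperplane `v^⊥`. -/
noncomputable abbrev refl (v : V) : V ≃ₗᵢ[ℝ] V := (ℝ ∙ v)ᗮ.reflection

lemma refl_apply {v : V} (hv : ‖v‖ = 1) (x : V) : refl v x = x - (2 * inner ℝ v x) • v := by
  rw [refl, Submodule.reflection_orthogonal_apply, Submodule.reflection_singleton_apply, hv]
  simp [two_smul, two_mul, add_smul]

lemma refl_self (v : V) : refl v v = -v :=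
  Submodule.reflection_orthogonalComplement_singleton_eq_neg v

lemma refl_refl (v x : V) : refl v (refl v x) = x := Submodule.reflection_reflection _ x

lemma refl_mul_self (v : V) : refl v * refl v = 1 := by
  ext x
  exact refl_refl v x

lemma inner_refl_right (v x y : V) : inner ℝ x (refl v y) = inner ℝ (refl v x) y := by
  rw [← (refl v).inner_map_map x, refl_refl]

lemma refl_eq_self_iff {v x : V} : refl v x = x ↔ inner ℝ v x = 0 := by
  rw [refl, Submodule.reflection_eq_self_iff, Submodule.mem_orthogonal_singleton_iff_inner_right]

lemma inner_isometry_right (w : V ≃ₗᵢ[ℝ] V) (x y : V) :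
    inner ℝ x (w y) = inner ℝ (w⁻¹ x) y := by
  rw [← w⁻¹.inner_map_map x]
  exact congrArg _ (w.symm_apply_apply y)

lemma refl_conj (w : V ≃ₗᵢ[ℝ] V) (v : V) : refl (w v) = w * refl v * w⁻¹ := by
  have h := Submodule.reflection_map w (ℝ ∙ v)ᗮ
  have h2 : Submodule.map (w.toLinearEquiv : V →ₗ[ℝ] V) (ℝ ∙ v)ᗮ = (ℝ ∙ (w v))ᗮ := by
    ext x
    rw [Submodule.mem_map, Submodule.mem_orthogonal_singleton_iff_inner_right]
    constructor
    · rintro ⟨y, hy, rfl⟩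
      rw [Submodule.mem_orthogonal_singleton_iff_inner_right] at hy
      simpa using hy
    · intro hx
      refine ⟨w⁻¹ x, ?_, w.apply_symm_apply x⟩
      rw [Submodule.mem_orthogonal_singleton_iff_inner_right, inner_isometry_right, inv_inv]
      exact hx
  rw [refl]
  ext x
  have h3 := Submodule.reflection_map_apply w (ℝ ∙ v)ᗮ x
  simp only [h2] at h3
  exact h3

lemma refl_smul {c : ℝ} (hc : c ≠ 0) (v : V) : refl (c • v) = refl v := by
  simp only [refl, Submodule.span_singleton_smul_eq (IsUnit.mk0 c hc) v]

lemma normals_smul {c : ℝ} (hc : c ≠ 0) {v : V} (hv : v ∈ normals W) : c • v ∈ normals W :=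
  ⟨smul_ne_zero hc hv.1, by
    have := refl_smul hc v
    rw [refl] at this
    rw [this]
    exact hv.2⟩

lemma normals_map {w : V ≃ₗᵢ[ℝ] V} (hw : w ∈ W) {v : V} (hv : v ∈ normals W) :
    w v ∈ normals W :=
  ⟨by simpa using hv.1, by
    have h := refl_conj w v
    rw [refl] at h
    rw [h]
    exact W.mul_mem (W.mul_mem hw hv.2) (W.inv_mem hw)⟩

/-- The normal vectors of norm one. -/
def unitNormals (W : Subgroup (V ≃ₗᵢ[ℝ] V)) : Set V := {v ∈ normals W | ‖v‖ = 1}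

lemma unitNormals_map {w : V ≃ₗᵢ[ℝ] V} (hw : w ∈ W) {v : V} (hv : v ∈ unitNormals W) :
    w v ∈ unitNormals W :=
  ⟨normals_map hw hv.1, by rw [w.norm_map, hv.2]⟩

lemma unitNormals_neg {v : V} (hv : v ∈ unitNormals W) : -v ∈ unitNormals W :=
  ⟨by simpa using normals_smul (neg_ne_zero.2 one_ne_zero) hv.1, by rw [norm_neg, hv.2]⟩

lemma exists_unitNormal {v : V} (hv : v ∈ normals W) :
    ∃ c : ℝ, 0 < c ∧ ∃ v' ∈ unitNormals W, v = c • v' := by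
  have h : 0 < ‖v‖ := norm_pos_iff.2 hv.1
  refine ⟨‖v‖, h, ‖v‖⁻¹ • v, ⟨normals_smul (inv_ne_zero h.ne') hv, ?_⟩, ?_⟩
  · rw [norm_smul, norm_inv, norm_norm, inv_mul_cancel₀ h.ne']
  · rw [smul_smul, mul_inv_cancel₀ h.ne', one_smul]

/-- A unit normal is determined up to sign by its reflection, so v ↦ `refl v` has fibres of at most
two elements over the finite group W. -/
lemma finite_unitNormals (hfin : Finite W) : (unitNormals W).Finite := by
  have hW : (W : Set (V ≃ₗᵢ[ℝ] V)).Finite := Set.toFinite _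
  refine Set.Finite.of_finite_fibers (fun v : V => refl v) (hW.subset ?_) ?_
  · rintro _ ⟨v, hv, rfl⟩
    exact hv.1.2
  · rintro r ⟨v, hv, rfl⟩
    refine (Set.toFinite ({v, -v} : Set V)).subset ?_
    rintro v' ⟨hv', h⟩
    have h' : refl v' v' = refl v v' := by rw [show refl v' = refl v from h]
    rw [refl_self, refl_apply hv.2] at h'
    have h2 : v' = (inner ℝ v v') • v := by
      have h3 : (2 : ℝ) • v' = (2 : ℝ) • ((inner ℝ v v') • v) := by
        rw [smul_smul, two_smul]
        nth_rewrite 1 [← neg_neg v']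
        rw [h']
        abel
      exact smul_right_injective V (two_ne_zero' ℝ) h3
    have h3 : |(inner ℝ v v' : ℝ)| = 1 := by
      have := hv'.2
      rw [h2, norm_smul, hv.2, mul_one] at this
      exact this
    rcases eq_or_eq_neg_of_abs_eq h3 with h4 | h4 <;> rw [h4] at h2 <;> simp [h2]

/-- The unit normals on the same side as `x₀`. -/
def positiveNormals (W : Subgroup (V ≃ₗᵢ[ℝ] V)) (x₀ : V) : Set V :=
  {v ∈ unitNormals W | 0 < inner ℝ v x₀}

/-- The point `x₀` lies on no reflection hyperplane. -/
def IsRegular (W : Subgroup (V ≃ₗᵢ[ℝ] V)) (x₀ : V) : Prop :=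
  ∀ v ∈ unitNormals W, (inner ℝ v x₀ : ℝ) ≠ 0

lemma IsRegular.neg_mem (h : IsRegular W x₀) {v : V} (hv : v ∈ unitNormals W)
    (hn : ¬ 0 < (inner ℝ v x₀ : ℝ)) : -v ∈ positiveNormals W x₀ := by
  refine ⟨unitNormals_neg hv, ?_⟩
  rw [inner_neg_left]
  have := h v hv
  have := lt_of_le_of_ne (not_lt.1 hn) this
  linarith

/-- A simple system: a minimal set of positive normals whose cone contains all of them. -/
structure IsSimpleSystem (W : Subgroup (V ≃ₗᵢ[ℝ] V)) (x₀ : V) (Δ : Set V) : Prop where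
  subset : Δ ⊆ positiveNormals W x₀
  le_span : positiveNormals W x₀ ⊆ Submodule.span ℝ≥0 Δ
  notMem : ∀ δ ∈ Δ, δ ∉ Submodule.span ℝ≥0 (Δ \ {δ})

lemma exists_isSimpleSystem (hfin : Finite W) (x₀ : V) : ∃ Δ, IsSimpleSystem W x₀ Δ := by
  have hP : (positiveNormals W x₀).Finite := (finite_unitNormals hfin).subset fun v hv => hv.1
  have hfin : {D : Set V | D ⊆ positiveNormals W x₀ ∧
      positiveNormals W x₀ ⊆ Submodule.span ℝ≥0 D}.Finite :=
    hP.finite_subsets.subset fun D hD => hD.1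
  obtain ⟨Δ, hΔ⟩ := hfin.exists_minimal ⟨positiveNormals W x₀, subset_rfl, Submodule.subset_span⟩
  refine ⟨Δ, hΔ.prop.1, hΔ.prop.2, fun δ hδ hmem => ?_⟩
  have hle : Δ ⊆ Submodule.span ℝ≥0 (Δ \ {δ}) := by
    intro v hv
    by_cases h : v = δ
    · exact h ▸ hmem
    · exact Submodule.subset_span ⟨hv, h⟩
  have := hΔ.le_of_le (y := Δ \ {δ}) ⟨Set.sdiff_subset.trans hΔ.prop.1,
    hΔ.prop.2.trans (Submodule.span_le.2 hle)⟩ Set.sdiff_subset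
  exact (this hδ).2 rfl

lemma inner_span_nonneg {S : Set V} {x : V} (hS : ∀ v ∈ S, 0 ≤ (inner ℝ v x : ℝ)) {z : V}
    (hz : z ∈ Submodule.span ℝ≥0 S) : 0 ≤ (inner ℝ z x : ℝ) := by
  induction hz using Submodule.span_induction with
  | mem v hv => exact hS v hv
  | zero => simp
  | add a b _ _ ha hb => rw [inner_add_left]; exact add_nonneg ha hb
  | smul c a _ ha =>
    rw [NNReal.smul_def, real_inner_smul_left]
    exact mul_nonneg (NNReal.coe_nonneg c) ha

lemma eq_zero_or_inner_span_pos {S : Set V} {x : V} (hS : ∀ v ∈ S, 0 < (inner ℝ v x : ℝ)) {z : V}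
    (hz : z ∈ Submodule.span ℝ≥0 S) : z = 0 ∨ 0 < (inner ℝ z x : ℝ) := by
  induction hz using Submodule.span_induction with
  | mem v hv => exact Or.inr (hS v hv)
  | zero => simp
  | add a b _ _ ha hb =>
    rw [inner_add_left]
    rcases ha with rfl | ha
    · simpa using hb
    · rcases hb with rfl | hb
      · right; simpa using ha
      · exact Or.inr (add_pos ha hb)
  | smul c a _ ha =>
    rw [NNReal.smul_def, real_inner_smul_left]
    rcases ha with rfl | ha
    · simp
    · rcases eq_or_lt_of_le (NNReal.coe_nonneg c) with hc | hc
      · left; rw [← hc, zero_smul]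
      · exact Or.inr (mul_pos hc ha)

variable {Δ : Set V}

/-- Otherwise v and the negative of its reflection both lie in the cone on Δ. Dropping their
δ-components leaves z and z' in the cone on the other simple normals, with z + z' a multiple of δ. A
positive multiple makes δ redundant; otherwise pairing with x₀ forces z = 0, and v is the unit
vector δ. -/
lemma IsSimpleSystem.refl_mem_positive (hΔ : IsSimpleSystem W x₀ Δ) (hx₀ : IsRegular W x₀)
    {δ v : V} (hδ : δ ∈ Δ) (hv : v ∈ positiveNormals W x₀) (hne : v ≠ δ) :
    refl δ v ∈ positiveNormals W x₀ := by
  have hδ1 := hΔ.subset hδ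
  have hmem : refl δ v ∈ unitNormals W := unitNormals_map hδ1.1.1.2 hv.1
  by_contra hcon
  have hβ := hx₀.neg_mem hmem fun h => hcon ⟨hmem, h⟩
  have hins : insert δ (Δ \ {δ}) = Δ := by
    rw [Set.insert_sdiff_singleton, Set.insert_eq_of_mem hδ]
  have h1 := hΔ.le_span hv
  have h2 := hΔ.le_span hβ
  rw [← hins, SetLike.mem_coe, Submodule.mem_span_insert] at h1 h2
  obtain ⟨a, z, hz, ha⟩ := h1
  obtain ⟨b, z', hz', hb⟩ := h2
  have hsum : z + z' = (2 * inner ℝ δ v - a - b) • δ := by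
    rw [refl_apply hδ1.1.2] at hb
    rw [NNReal.smul_def] at ha hb
    have : z' = -(v - (2 * inner ℝ δ v) • δ) - (b : ℝ) • δ := by rw [hb]; abel
    have hz2 : z = v - (a : ℝ) • δ := by rw [eq_sub_iff_add_eq', ← ha]
    rw [this, hz2]
    module
  have hpos : ∀ u ∈ Δ \ {δ}, 0 < (inner ℝ u x₀ : ℝ) := fun u hu => (hΔ.subset hu.1).2
  have hzz := eq_zero_or_inner_span_pos hpos (Submodule.add_mem _ hz hz')
  rcases lt_or_ge 0 (2 * inner ℝ δ v - a - b : ℝ) with hm | hm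
  · refine hΔ.notMem δ hδ ?_
    have h := Submodule.smul_mem _ (Real.toNNReal (2 * inner ℝ δ v - a - b)⁻¹)
      (Submodule.add_mem _ hz hz')
    rwa [hsum, NNReal.smul_def, Real.coe_toNNReal _ (inv_pos.2 hm).le, smul_smul,
      inv_mul_cancel₀ hm.ne', one_smul] at h
  · have hle : (inner ℝ (z + z') x₀ : ℝ) ≤ 0 := by
      rw [hsum, real_inner_smul_left]
      exact mul_nonpos_of_nonpos_of_nonneg hm hδ1.2.le
    rw [inner_add_left] at hle
    have h0 : z = 0 := by
      rcases eq_zero_or_inner_span_pos hpos hz with h | h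
      · exact h
      · have := inner_span_nonneg (fun u hu => (hpos u hu).le) hz'
        linarith
    rw [h0, add_zero, NNReal.smul_def] at ha
    have hnorm := hv.1.2
    rw [ha, norm_smul, hδ1.1.2, mul_one, Real.norm_of_nonneg (NNReal.coe_nonneg a)] at hnorm
    rw [hnorm, one_smul] at ha
    exact hne ha

/-- Every reflection in `W` is a product of simple reflections. -/
lemma IsSimpleSystem.refl_mem_closure (hfin : Finite W) (hΔ : IsSimpleSystem W x₀ Δ)
    (hx₀ : IsRegular W x₀) {v : V} (hv : v ∈ positiveNormals W x₀) :
    refl v ∈ Subgroup.closure (refl '' Δ) := by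
  set W₀ := Subgroup.closure (refl '' Δ)
  have hP : (positiveNormals W x₀).Finite := (finite_unitNormals hfin).subset fun v hv => hv.1
  have hO : {u ∈ positiveNormals W x₀ | ∃ w ∈ W₀, u = w v}.Finite := hP.subset fun u hu => hu.1
  -- The positive normal of least height ⟨u, x₀⟩ in the orbit of v under the simple reflections must
  -- be simple: otherwise some δ in Δ pairs positively with it, and reflecting in δ lowers the
  -- height while staying positive.
  obtain ⟨u, ⟨hu, w, hw, rfl⟩, hmin⟩ := Set.exists_min_image _ (fun u => (inner ℝ u x₀ : ℝ)) hO
    ⟨v, hv, 1, W₀.one_mem, rfl⟩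
  suffices h : w v ∈ Δ by
    have h1 : refl (w v) ∈ W₀ := Subgroup.subset_closure ⟨_, h, rfl⟩
    have h2 : refl v = w⁻¹ * refl (w v) * w := by rw [refl_conj]; group
    rw [h2]
    exact W₀.mul_mem (W₀.mul_mem (W₀.inv_mem hw) h1) hw
  by_contra hnot
  obtain ⟨δ, hδ, hpos⟩ : ∃ δ ∈ Δ, 0 < (inner ℝ δ (w v) : ℝ) := by
    by_contra! h
    have h1 := inner_span_nonneg (S := Δ) (x := -(w v))
      (fun δ hδ => by rw [inner_neg_right]; linarith [h δ hδ]) (hΔ.le_span hu)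
    rw [inner_neg_right, real_inner_self_eq_norm_sq, hu.1.2] at h1
    norm_num at h1
  have hδ1 := hΔ.subset hδ
  have hmem := hΔ.refl_mem_positive hx₀ hδ hu (fun h => hnot (h ▸ hδ))
  have h1 := hmin (refl δ (w v)) ⟨hmem, refl δ * w,
    W₀.mul_mem (Subgroup.subset_closure ⟨_, hδ, rfl⟩) hw, rfl⟩
  rw [refl_apply hδ1.1.2, inner_sub_left, real_inner_smul_left] at h1
  have := mul_pos hpos hδ1.2
  linarith

lemma IsSimpleSystem.exists_list (hW : IsFiniteReflectionGroup W) (hΔ : IsSimpleSystem W x₀ Δ)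
    (hx₀ : IsRegular W x₀) {w : V ≃ₗᵢ[ℝ] V} (hw : w ∈ W) :
    ∃ l : List V, (∀ δ ∈ l, δ ∈ Δ) ∧ w = (l.map refl).prod := by
  have h1 : W ≤ Subgroup.closure (refl '' Δ) := by
    rw [hW.2, Subgroup.closure_le]
    rintro _ ⟨v, hv, rfl⟩
    obtain ⟨c, hc, v', hv', rfl⟩ := exists_unitNormal hv
    show refl (c • v') ∈ _
    rw [refl_smul hc.ne']
    by_cases h : 0 < (inner ℝ v' x₀ : ℝ)
    · exact hΔ.refl_mem_closure hW.1 hx₀ ⟨hv', h⟩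
    · have := hΔ.refl_mem_closure hW.1 hx₀ (hx₀.neg_mem hv' h)
      rwa [← neg_one_smul ℝ v', refl_smul (neg_ne_zero.2 one_ne_zero)] at this
  have h2 := h1 hw
  induction h2 using Subgroup.closure_induction_left with
  | one => exact ⟨[], by simp, rfl⟩
  | mul_left r hr y _ ih =>
    obtain ⟨δ, hδ, rfl⟩ := hr
    have hδW : refl δ ∈ W := (hΔ.subset hδ).1.1.2
    obtain ⟨l, hl, hy⟩ := ih ((W.mul_mem_cancel_left hδW).1 hw)
    exact ⟨δ :: l, by simpa using ⟨hδ, hl⟩, by simp [hy]⟩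
  | inv_mul_cancel r hr y _ ih =>
    obtain ⟨δ, hδ, rfl⟩ := hr
    have hδW : (refl δ)⁻¹ ∈ W := W.inv_mem (hΔ.subset hδ).1.1.2
    obtain ⟨l, hl, hy⟩ := ih ((W.mul_mem_cancel_left hδW).1 hw)
    refine ⟨δ :: l, by simpa using ⟨hδ, hl⟩, ?_⟩
    rw [List.map_cons, List.prod_cons, ← hy, inv_eq_of_mul_eq_one_left (refl_mul_self δ)]

/-- The exchange condition. -/
lemma IsSimpleSystem.exchange (hΔ : IsSimpleSystem W x₀ Δ) (hx₀ : IsRegular W x₀) (l : List V)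
    (hl : ∀ δ ∈ l, δ ∈ Δ) {γ : V} (hγ : γ ∈ positiveNormals W x₀)
    (hneg : (inner ℝ γ ((l.map refl).prod x₀) : ℝ) < 0) :
    ∃ l' : List V, (∀ δ ∈ l', δ ∈ Δ) ∧ l'.length + 1 = l.length ∧
      refl γ * (l.map refl).prod = (l'.map refl).prod := by
  induction l generalizing γ with
  | nil =>
    have := hγ.2
    exact absurd hneg (not_lt.2 this.le)
  | cons δ l ih =>
    have hδ : δ ∈ Δ := hl δ (by simp)
    have hl' : ∀ δ ∈ l, δ ∈ Δ := fun δ' h => hl δ' (by simp [h])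
    -- If γ is the first letter, that letter is cancelled. If not, reflecting γ in δ keeps it
    -- positive, and the problem passes to the tail.
    by_cases hγδ : γ = δ
    · subst hγδ
      exact ⟨l, hl', by simp, by
        rw [List.map_cons, List.prod_cons, ← mul_assoc, refl_mul_self, one_mul]⟩
    · have hγ' := hΔ.refl_mem_positive hx₀ hδ hγ hγδ
      have hneg' : (inner ℝ (refl δ γ) ((l.map refl).prod x₀) : ℝ) < 0 := by
        rw [← inner_refl_right]
        exact hneg
      obtain ⟨l'', h1, h2, h3⟩ := ih hl' hγ' hneg'
      refine ⟨δ :: l'', by simpa using ⟨hδ, h1⟩, by simp [h2], ?_⟩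
      rw [refl_conj, inv_eq_of_mul_eq_one_left (refl_mul_self δ)] at h3
      rw [List.map_cons, List.prod_cons, List.map_cons, List.prod_cons, ← h3, ← mul_assoc (refl δ),
        ← mul_assoc (refl δ), ← mul_assoc (refl δ), refl_mul_self, one_mul, mul_assoc]

/-- If a nonempty word keeps x₀ in the chamber, its tail must send x₀ to the negative side of the
first letter. Exchange then rewrites the whole word with two letters fewer, whence strong induction.
-/
lemma IsSimpleSystem.eq_one (hΔ : IsSimpleSystem W x₀ Δ) (hx₀ : IsRegular W x₀) (n : ℕ) :
    ∀ l : List V, l.length = n → (∀ δ ∈ l, δ ∈ Δ) →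
      (∀ δ ∈ Δ, 0 ≤ (inner ℝ δ ((l.map refl).prod x₀) : ℝ)) → (l.map refl).prod = 1 := by
  induction n using Nat.strong_induction_on with
  | _ n ih =>
    rintro (_ | ⟨δ, l⟩) hn hl hpos
    · rfl
    have hδ : δ ∈ Δ := hl δ (by simp)
    have hl' : ∀ δ ∈ l, δ ∈ Δ := fun δ' h => hl δ' (by simp [h])
    have hδ1 := hΔ.subset hδ
    have hWl : ∀ l : List V, (∀ δ ∈ l, δ ∈ Δ) → (l.map refl).prod ∈ W := fun l hl =>
      W.list_prod_mem (by
        intro w hw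
        obtain ⟨δ', h, rfl⟩ := List.mem_map.1 hw
        exact (hΔ.subset (hl δ' h)).1.1.2)
    have hreg : (inner ℝ δ (((δ :: l).map refl).prod x₀) : ℝ) ≠ 0 := by
      rw [inner_isometry_right]
      exact hx₀ _ (unitNormals_map (W.inv_mem (hWl _ hl)) hδ1.1)
    have hneg : (inner ℝ δ ((l.map refl).prod x₀) : ℝ) < 0 := by
      have h1 := lt_of_le_of_ne (hpos δ hδ) hreg.symm
      rw [List.map_cons, List.prod_cons] at h1
      change 0 < (inner ℝ δ (refl δ ((l.map refl).prod x₀)) : ℝ) at h1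
      rw [inner_refl_right, refl_self, inner_neg_left] at h1
      linarith
    obtain ⟨l', h1, h2, h3⟩ := hΔ.exchange hx₀ l hl' hδ1 hneg
    rw [List.map_cons, List.prod_cons, h3] at hpos ⊢
    exact ih l'.length (by simp at hn; omega) l' rfl h1 hpos

/-- If w moves x₀ to the negative side of δ, then w y, being in the closed chamber, must lie on the
hyperplane of δ. The reflection in δ therefore fixes w y, and composing w with it shortens the word
without changing the image of y. -/
lemma IsSimpleSystem.fundamental (hΔ : IsSimpleSystem W x₀ Δ) (hx₀ : IsRegular W x₀) (n : ℕ) :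
    ∀ l : List V, l.length = n → (∀ δ ∈ l, δ ∈ Δ) → ∀ y : V,
      (∀ v ∈ positiveNormals W x₀, 0 ≤ (inner ℝ v y : ℝ)) →
      (∀ v ∈ positiveNormals W x₀, 0 ≤ (inner ℝ v ((l.map refl).prod y) : ℝ)) →
      (l.map refl).prod y = y ∧
        (l.map refl).prod ∈ Subgroup.closure (refl '' {v ∈ normals W | inner ℝ v y = 0}) := by
  induction n with
  | zero =>
    intro l hn hl y _ _
    rw [List.length_eq_zero_iff] at hn
    subst hn
    exact ⟨rfl, one_mem _⟩
  | succ n ih =>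
    intro l hn hl y hy hwy
    by_cases hpos : ∀ δ ∈ Δ, 0 ≤ (inner ℝ δ ((l.map refl).prod x₀) : ℝ)
    · rw [hΔ.eq_one hx₀ _ l rfl hl hpos]
      exact ⟨rfl, one_mem _⟩
    push Not at hpos
    obtain ⟨δ, hδ, hneg⟩ := hpos
    have hδ1 := hΔ.subset hδ
    obtain ⟨l', h1, h2, h3⟩ := hΔ.exchange hx₀ l hl hδ1 hneg
    set w := (l.map refl).prod with hw
    have hwW : w ∈ W := W.list_prod_mem (by
        intro w hw
        obtain ⟨δ', h, rfl⟩ := List.mem_map.1 hw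
        exact (hΔ.subset (hl δ' h)).1.1.2)
    have hzero : (inner ℝ δ (w y) : ℝ) = 0 := by
      refine le_antisymm ?_ (hwy δ hδ1)
      rw [inner_isometry_right] at hneg ⊢
      have := hy _ (hx₀.neg_mem (unitNormals_map (W.inv_mem hwW) hδ1.1) (not_lt.2 hneg.le))
      rw [inner_neg_left] at this
      linarith
    have hfix : (refl δ * w) y = w y := refl_eq_self_iff.2 hzero
    have := ih l' (by omega) h1 y hy (by rw [← h3, hfix]; exact hwy)
    rw [← h3, hfix] at this
    refine ⟨this.1, ?_⟩
    rw [this.1] at hzero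
    have h4 : refl δ ∈ Subgroup.closure (refl '' {v ∈ normals W | inner ℝ v y = 0}) :=
      Subgroup.subset_closure ⟨δ, ⟨hδ1.1.1, hzero⟩, rfl⟩
    exact (Subgroup.mul_mem_cancel_left _ h4).1 this.2

/-- The closed chamber of `x₀` is a strict fundamental domain, and the stabilizers of its points
are generated by reflections. -/
lemma fundamental_domain (hW : IsFiniteReflectionGroup W) (hx₀ : IsRegular W x₀)
    {w : V ≃ₗᵢ[ℝ] V} (hw : w ∈ W) {y : V}
    (hy : ∀ v ∈ positiveNormals W x₀, 0 ≤ (inner ℝ v y : ℝ))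
    (hwy : ∀ v ∈ positiveNormals W x₀, 0 ≤ (inner ℝ v (w y) : ℝ)) :
    w y = y ∧ w ∈ Subgroup.closure (refl '' {v ∈ normals W | inner ℝ v y = 0}) := by
  obtain ⟨Δ, hΔ⟩ := exists_isSimpleSystem hW.1 x₀
  obtain ⟨l, hl, rfl⟩ := hΔ.exists_list hW hx₀ hw
  exact hΔ.fundamental hx₀ _ l rfl hl y hy hwy

/-- The point of the orbit of y with the largest product with x₀ works: reflecting it in a violated
wall would increase that product. -/
lemma exists_map_mem_closedChamber (hfin : Finite W) (x₀ y : V) :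
    ∃ w ∈ W, ∀ v ∈ positiveNormals W x₀, 0 ≤ (inner ℝ v (w y) : ℝ) := by
  have hWf : (W : Set (V ≃ₗᵢ[ℝ] V)).Finite := Set.toFinite _
  obtain ⟨w, hw, hmax⟩ := Set.exists_max_image _ (fun w : V ≃ₗᵢ[ℝ] V => (inner ℝ (w y) x₀ : ℝ)) hWf
    ⟨1, W.one_mem⟩
  refine ⟨w, hw, fun v hv => ?_⟩
  by_contra! hneg
  have h1 : (inner ℝ (refl v (w y)) x₀ : ℝ) ≤ inner ℝ (w y) x₀ :=
    hmax (refl v * w) (W.mul_mem hv.1.1.2 hw)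
  rw [refl_apply hv.1.2, inner_sub_left, real_inner_smul_left] at h1
  have := mul_neg_of_neg_of_pos hneg hv.2
  linarith

end SimpleSystems

/-! ### Sign vectors, faces and chambers. -/

section Signs

open Filter Topology

variable {V : Type u} [NormedAddCommGroup V] [InnerProductSpace ℝ V]
  {W : Subgroup (V ≃ₗᵢ[ℝ] V)}

lemma sign_inner_smul {c : ℝ} (hc : 0 < c) (v x : V) :
    SignType.sign (inner ℝ (c • v) x : ℝ) = SignType.sign (inner ℝ v x : ℝ) := by
  rw [real_inner_smul_left, sign_mul, sign_pos hc, one_mul]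

lemma sign_inner_smul_right {c : ℝ} (hc : 0 < c) (v x : V) :
    SignType.sign (inner ℝ v (c • x) : ℝ) = SignType.sign (inner ℝ v x : ℝ) := by
  rw [real_inner_smul_right, sign_mul, sign_pos hc, one_mul]

lemma sign_add_of_sign_eq {a b : ℝ} (h : SignType.sign a = SignType.sign b) :
    SignType.sign (a + b) = SignType.sign b := by
  rcases lt_trichotomy b 0 with hb | rfl | hb
  · rw [sign_neg hb, sign_eq_neg_one_iff] at h
    rw [sign_neg hb, sign_neg (by linarith)]
  · rw [sign_zero, sign_eq_zero_iff] at h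
    simp [h]
  · rw [sign_pos hb, sign_eq_one_iff] at h
    rw [sign_pos hb, sign_pos (by linarith)]

lemma eq_zero_iff_of_sign_eq {a b : ℝ} (h : SignType.sign a = SignType.sign b) :
    a = 0 ↔ b = 0 := by
  rw [← sign_eq_zero_iff, h, sign_eq_zero_iff]

lemma eventually_sign_inner_eq (v : V) {x₀ : V} (h : (inner ℝ v x₀ : ℝ) ≠ 0) :
    ∀ᶠ x in 𝓝 x₀, SignType.sign (inner ℝ v x : ℝ) = SignType.sign (inner ℝ v x₀ : ℝ) := by
  have hc : Continuous fun x : V => (inner ℝ v x : ℝ) := by fun_prop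
  rcases lt_or_gt_of_ne h with h | h
  · filter_upwards [hc.continuousAt.eventually (gt_mem_nhds h)] with x hx
    rw [sign_neg h, sign_neg hx]
  · filter_upwards [hc.continuousAt.eventually (lt_mem_nhds h)] with x hx
    rw [sign_pos h, sign_pos hx]

lemma eventually_forall_sign_eq (hfin : Finite W) (x₀ : V) :
    ∀ᶠ x in 𝓝 x₀, ∀ v ∈ normals W, (inner ℝ v x₀ : ℝ) ≠ 0 →
      SignType.sign (inner ℝ v x : ℝ) = SignType.sign (inner ℝ v x₀ : ℝ) := by
  have h : ∀ᶠ x in 𝓝 x₀, ∀ v ∈ unitNormals W, (inner ℝ v x₀ : ℝ) ≠ 0 →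
      SignType.sign (inner ℝ v x : ℝ) = SignType.sign (inner ℝ v x₀ : ℝ) := by
    rw [(finite_unitNormals hfin).eventually_all]
    intro v _
    rw [eventually_imp_distrib_left]
    exact eventually_sign_inner_eq v
  filter_upwards [h] with x hx v hv hne
  obtain ⟨c, hc, v', hv', rfl⟩ := exists_unitNormal hv
  rw [sign_inner_smul hc, sign_inner_smul hc]
  refine hx v' hv' fun h0 => hne ?_
  rw [real_inner_smul_left, h0, mul_zero]

/-- Adding a large multiple of `y` to `x` moves `x` to the side of `y` on every hyperplane that
does not contain `y`. -/
lemma exists_sign_add_smul (hfin : Finite W) (x y : V) :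
    ∃ s : ℝ, 0 < s ∧ ∀ v ∈ normals W, (inner ℝ v y : ℝ) ≠ 0 →
      SignType.sign (inner ℝ v (x + s • y) : ℝ) = SignType.sign (inner ℝ v y : ℝ) := by
  -- After rescaling by t = 1/s, the claim is that y + t x has the signs of y, where these are
  -- nonzero, for small positive t.
  have hc : Tendsto (fun t : ℝ => y + t • x) (𝓝[>] 0) (𝓝 y) := by
    have : Continuous fun t : ℝ => y + t • x := by fun_prop
    have h := this.tendsto 0
    simp only [zero_smul, add_zero] at h
    exact h.mono_left nhdsWithin_le_nhds
  obtain ⟨t, ht, ht0⟩ := ((hc.eventually (eventually_forall_sign_eq hfin y)).and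
    self_mem_nhdsWithin).exists
  have ht0 : 0 < t := ht0
  refine ⟨t⁻¹, inv_pos.2 ht0, fun v hv hne => ?_⟩
  rw [← ht v hv hne, ← sign_inner_smul_right ht0 v (x + t⁻¹ • y), smul_add, smul_smul,
    mul_inv_cancel₀ ht0.ne', one_smul, add_comm]

lemma convex_sign_inner (v : V) (s : SignType) :
    Convex ℝ {x : V | SignType.sign (inner ℝ v x : ℝ) = s} := by
  have hl : IsLinearMap ℝ fun x : V => (inner ℝ v x : ℝ) := (innerₛₗ ℝ v).isLinear
  rcases s.trichotomy with rfl | rfl | rfl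
  · simp only [sign_eq_neg_one_iff]
    exact convex_halfSpace_lt hl 0
  · simp only [sign_eq_zero_iff]
    exact convex_hyperplane hl 0
  · simp only [sign_eq_one_iff]
    exact convex_halfSpace_gt hl 0

lemma convex_faceOf (x : V) : Convex ℝ (faceOf W x) := by
  have : faceOf W x = ⋂ v ∈ normals W,
      {y : V | SignType.sign (inner ℝ v y : ℝ) = SignType.sign (inner ℝ v x : ℝ)} := by
    ext y
    simp [faceOf]
  rw [this]
  exact convex_iInter₂ fun v _ => convex_sign_inner v _

lemma mem_faceOf_self (x : V) : x ∈ faceOf W x := fun _ _ => rfl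

/-- Nonzero signs are locally constant, so they survive approximation. Conversely, c' + t d lies in
the face of d for every t > 0 and tends to c' as t tends to 0. -/
lemma faceOf_subset_closure_iff (c d : V) : faceOf W c ⊆ closure (faceOf W d) ↔
    ∀ v ∈ normals W, (inner ℝ v c : ℝ) ≠ 0 →
      SignType.sign (inner ℝ v c : ℝ) = SignType.sign (inner ℝ v d : ℝ) := by
  constructor
  · intro h v hv hne
    have h1 := mem_closure_iff_frequently.1 (h (mem_faceOf_self c))
    obtain ⟨x, hx, hx'⟩ := (h1.and_eventually (eventually_sign_inner_eq v hne)).exists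
    rw [← hx', hx v hv]
  · intro h c' hc'
    have hc : Tendsto (fun t : ℝ => c' + t • d) (𝓝[>] 0) (𝓝 c') := by
      have : Continuous fun t : ℝ => c' + t • d := by fun_prop
      have h := this.tendsto 0
      simp only [zero_smul, add_zero] at h
      exact h.mono_left nhdsWithin_le_nhds
    refine mem_closure_of_tendsto hc ?_
    filter_upwards [self_mem_nhdsWithin] with t ht v hv
    have ht : 0 < t := ht
    rw [inner_add_right]
    by_cases h0 : (inner ℝ v c : ℝ) = 0
    · rw [(eq_zero_iff_of_sign_eq (hc' v hv)).2 h0, zero_add, sign_inner_smul_right ht]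
    · rw [← sign_inner_smul_right ht v d]
      refine sign_add_of_sign_eq ?_
      rw [sign_inner_smul_right ht, hc' v hv, h v hv h0]

lemma mem_hyperplane_iff {v x : V} : x ∈ (ℝ ∙ v)ᗮ ↔ (inner ℝ v x : ℝ) = 0 :=
  Submodule.mem_orthogonal_singleton_iff_inner_right

/-- On a connected set missing the hyperplanes, each normal has constant sign by the intermediate
value property; conversely a face is convex, hence connected. -/
lemma IsChamber.exists_eq_faceOf {C : Set V} (hC : IsChamber W C) :
    ∃ x₀, (∀ v ∈ normals W, (inner ℝ v x₀ : ℝ) ≠ 0) ∧ C = faceOf W x₀ := by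
  obtain ⟨x₀, hx₀, rfl⟩ := hC
  have hmem : ∀ x, x ∈ (⋃ H ∈ hyperplanes W, (H : Set V))ᶜ ↔
      ∀ v ∈ normals W, (inner ℝ v x : ℝ) ≠ 0 := by
    intro x
    simp [hyperplanes, mem_hyperplane_iff]
  rw [hmem] at hx₀
  refine ⟨x₀, hx₀, Set.Subset.antisymm ?_ ?_⟩
  · intro x hx v hv
    by_contra hne
    have hpre := (isPreconnected_connectedComponentIn
      (F := (⋃ H ∈ hyperplanes W, (H : Set V))ᶜ) (x := x₀)).image (fun y : V => (inner ℝ v y : ℝ))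
      (by fun_prop)
    have hx₀' := mem_connectedComponentIn ((hmem x₀).2 hx₀)
    have h0 : (0 : ℝ) ∉ (fun y : V => (inner ℝ v y : ℝ)) ''
        connectedComponentIn (⋃ H ∈ hyperplanes W, (H : Set V))ᶜ x₀ := by
      rintro ⟨y, hy, h⟩
      exact (hmem y).1 (connectedComponentIn_subset _ _ hy) v hv h
    have hxne := (hmem x).1 (connectedComponentIn_subset _ _ hx) v hv
    have hord := hpre.ordConnected
    rcases lt_or_gt_of_ne hxne with h1 | h1 <;> rcases lt_or_gt_of_ne (hx₀ v hv) with h2 | h2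
    · exact hne (by rw [sign_neg h1, sign_neg h2])
    · exact h0 (hord.out ⟨x, hx, rfl⟩ ⟨x₀, hx₀', rfl⟩ ⟨h1.le, h2.le⟩)
    · exact h0 (hord.out ⟨x₀, hx₀', rfl⟩ ⟨x, hx, rfl⟩ ⟨h2.le, h1.le⟩)
    · exact hne (by rw [sign_pos h1, sign_pos h2])
  · refine (convex_faceOf x₀).isPreconnected.subset_connectedComponentIn (mem_faceOf_self x₀) ?_
    intro x hx
    rw [hmem]
    intro v hv h
    exact hx₀ v hv ((eq_zero_iff_of_sign_eq (hx v hv)).1 h)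

end Signs

/-! ### Invariant sign-determined classes and their images in the quotient. -/

section Classes

variable {V : Type u} [NormedAddCommGroup V] [InnerProductSpace ℝ V]
  {W : Subgroup (V ≃ₗᵢ[ℝ] V)}

lemma proj_eq_iff {z z' : Complexified V} :
    proj W z = proj W z' ↔ ∃ w ∈ W, Prod.map w w z = z' := by
  refine (Quotient.eq (r := complexSetoid W)).trans ?_
  refine exists_congr fun w => and_congr_right fun _ => ?_
  rw [Prod.ext_iff, Prod.map_fst, Prod.map_snd]

lemma proj_surjective : Function.Surjective (proj W) := Quotient.mk_surjective

lemma continuous_proj : Continuous (proj W) := continuous_quotient_mk'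

/-- A family of subsets of the complexification, indexed by its points, which is the family of
the classes of a `W`-invariant equivalence relation determined by the signs of the normals. -/
structure IsClassMap (W : Subgroup (V ≃ₗᵢ[ℝ] V)) (K : Complexified V → Set (Complexified V)) :
    Prop where
  mem_of_sign : ∀ z z' : Complexified V,
    (∀ v ∈ normals W, SignType.sign (inner ℝ v z'.1 : ℝ) = SignType.sign (inner ℝ v z.1 : ℝ) ∧
      SignType.sign (inner ℝ v z'.2 : ℝ) = SignType.sign (inner ℝ v z.2 : ℝ)) → z' ∈ K z
  eq_of_mem : ∀ z z', z' ∈ K z → K z' = K z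
  map_mem : ∀ w ∈ W, ∀ z z', z' ∈ K z → Prod.map w w z' ∈ K (Prod.map w w z)

/-- The images in the quotient of the classes of a class map. -/
def family (W : Subgroup (V ≃ₗᵢ[ℝ] V)) (K : Complexified V → Set (Complexified V)) :
    Set (Set (ComplexQuotient W)) :=
  Set.range fun z => proj W '' K z

variable {K K' : Complexified V → Set (Complexified V)}

lemma IsClassMap.mem_self (hK : IsClassMap W K) (z : Complexified V) : z ∈ K z :=
  hK.mem_of_sign z z fun _ _ => ⟨rfl, rfl⟩

lemma IsClassMap.proj_mem_iff (hK : IsClassMap W K) {z z' : Complexified V} :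
    proj W z' ∈ proj W '' K z ↔ ∃ w ∈ W, z' ∈ K (Prod.map w w z) := by
  constructor
  · rintro ⟨z'', hz'', h⟩
    obtain ⟨w, hw, rfl⟩ := proj_eq_iff.1 h
    exact ⟨w, hw, hK.map_mem w hw _ _ hz''⟩
  · rintro ⟨w, hw, h⟩
    refine ⟨Prod.map (w⁻¹ : V ≃ₗᵢ[ℝ] V) (w⁻¹ : V ≃ₗᵢ[ℝ] V) z', ?_, proj_eq_iff.2 ⟨w, hw, ?_⟩⟩
    · have := hK.map_mem w⁻¹ (W.inv_mem hw) _ _ h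
      rw [Prod.map_map] at this
      convert this
      exact Prod.ext (w.symm_apply_apply z.1).symm (w.symm_apply_apply z.2).symm
    · exact Prod.ext (w.apply_symm_apply z'.1) (w.apply_symm_apply z'.2)

lemma IsClassMap.image_map (hK : IsClassMap W K) {w : V ≃ₗᵢ[ℝ] V} (hw : w ∈ W)
    (z : Complexified V) : proj W '' K (Prod.map w w z) = proj W '' K z := by
  have key : ∀ w ∈ W, ∀ z, proj W '' K z ⊆ proj W '' K (Prod.map w w z) := by
    rintro w hw z _ ⟨z', hz', rfl⟩
    exact ⟨_, hK.map_mem w hw z z' hz', (proj_eq_iff.2 ⟨w, hw, rfl⟩).symm⟩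
  refine (key w hw z).antisymm' ?_
  have h := key w⁻¹ (W.inv_mem hw) (Prod.map w w z)
  have e : Prod.map (w⁻¹ : V ≃ₗᵢ[ℝ] V) (w⁻¹ : V ≃ₗᵢ[ℝ] V) (Prod.map w w z) = z :=
    Prod.ext (w.symm_apply_apply z.1) (w.symm_apply_apply z.2)
  rwa [e] at h

lemma IsClassMap.image_eq (hK : IsClassMap W K) {z z' : Complexified V}
    (h : proj W z' ∈ proj W '' K z) : proj W '' K z' = proj W '' K z := by
  obtain ⟨w, hw, h⟩ := hK.proj_mem_iff.1 h
  rw [hK.eq_of_mem _ _ h, hK.image_map hw]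

lemma IsClassMap.eq_image (hK : IsClassMap W K) {A : Set (ComplexQuotient W)} (hA : A ∈ family W K)
    {z : Complexified V} (hz : proj W z ∈ A) : A = proj W '' K z := by
  obtain ⟨z', rfl⟩ := hA
  exact (hK.image_eq hz).symm

lemma IsClassMap.proj_mem (hK : IsClassMap W K) (z : Complexified V) :
    proj W z ∈ proj W '' K z :=
  ⟨z, hK.mem_self z, rfl⟩

lemma IsClassMap.isPartition (hK : IsClassMap W K) : Setoid.IsPartition (family W K) := by
  refine ⟨?_, fun q => ?_⟩
  · rintro ⟨z, hz⟩
    have := hK.proj_mem z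
    rw [show proj W '' K z = ∅ from hz] at this
    exact this
  · obtain ⟨z, rfl⟩ := proj_surjective q
    exact ⟨proj W '' K z, ⟨⟨z, rfl⟩, hK.proj_mem z⟩, fun A hA => hK.eq_image hA.1 hA.2⟩

/-- A class depends only on the signs of the finitely many unit normals at the real and imaginary
parts. -/
lemma IsClassMap.finite_family (hfin : Finite W) (hK : IsClassMap W K) :
    (family W K).Finite := by
  have := (finite_unitNormals hfin).to_subtype
  let sg : Complexified V → (unitNormals W → SignType × SignType) := fun z v =>
    (SignType.sign (inner ℝ v.1 z.1 : ℝ), SignType.sign (inner ℝ v.1 z.2 : ℝ))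
  have hsg : ∀ z z', sg z = sg z' → proj W '' K z = proj W '' K z' := by
    intro z z' h
    rw [hK.eq_of_mem z' z (hK.mem_of_sign _ _ fun v hv => ?_)]
    obtain ⟨c, hc, v', hv', rfl⟩ := exists_unitNormal hv
    simp only [sign_inner_smul hc]
    exact Prod.ext_iff.1 (congrFun h ⟨v', hv'⟩)
  refine (Set.finite_range fun s : Set.range sg => proj W '' K s.2.choose).subset ?_
  rintro _ ⟨z, rfl⟩
  exact ⟨⟨sg z, z, rfl⟩, hsg _ _ (Exists.choose_spec (⟨z, rfl⟩ : ∃ y, sg y = sg z))⟩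

lemma IsClassMap.isFinitePartition (hfin : Finite W) (hK : IsClassMap W K) :
    IsFinitePartition (family W K) :=
  ⟨hK.finite_family hfin, hK.isPartition⟩

lemma IsClassMap.refines (hK : IsClassMap W K) (hK' : IsClassMap W K') (h : ∀ z, K z ⊆ K' z) :
    Refines (family W K) (family W K') := by
  intro B hB
  refine ⟨{A ∈ family W K | A ⊆ B}, fun A hA => hA.1, Set.Subset.antisymm ?_ ?_⟩
  · intro q hq
    obtain ⟨z, rfl⟩ := proj_surjective q
    rw [hK'.eq_image hB hq]
    exact ⟨proj W '' K z, ⟨⟨z, rfl⟩, Set.image_mono (h z)⟩, hK.proj_mem z⟩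
  · exact Set.sUnion_subset fun A hA => hA.2

/-- The points whose imaginary part lies in the same face. -/
def imClass (W : Subgroup (V ≃ₗᵢ[ℝ] V)) (z : Complexified V) : Set (Complexified V) :=
  {z' | z'.2 ∈ faceOf W z.2}

/-- The points which lie in the same cell. -/
def cellClass (W : Subgroup (V ≃ₗᵢ[ℝ] V)) (z : Complexified V) : Set (Complexified V) :=
  {z' | z'.2 ∈ faceOf W z.2 ∧ ∀ v ∈ normals W, (inner ℝ v z.2 : ℝ) = 0 →
    SignType.sign (inner ℝ v z'.1 : ℝ) = SignType.sign (inner ℝ v z.1 : ℝ)}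

/-- The points which lie in the same complexified hyperplanes. -/
def flatClass (W : Subgroup (V ≃ₗᵢ[ℝ] V)) (z : Complexified V) : Set (Complexified V) :=
  {z' | ∀ v ∈ normals W, ((inner ℝ v z'.1 : ℝ) = 0 ∧ (inner ℝ v z'.2 : ℝ) = 0) ↔
    ((inner ℝ v z.1 : ℝ) = 0 ∧ (inner ℝ v z.2 : ℝ) = 0)}

/-- The class map obtained by exchanging real and imaginary parts. -/
def swapClass (K : Complexified V → Set (Complexified V)) (z : Complexified V) :
    Set (Complexified V) :=
  {z' | z'.swap ∈ K z.swap}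

lemma faceOf_eq_of_mem {x y : V} (h : x ∈ faceOf W y) : faceOf W x = faceOf W y := by
  ext z
  exact forall₂_congr fun v hv => by rw [h v hv]

lemma faceOf_map {w : V ≃ₗᵢ[ℝ] V} (hw : w ∈ W) {x y : V} (h : x ∈ faceOf W y) :
    w x ∈ faceOf W (w y) := by
  intro v hv
  rw [inner_isometry_right, inner_isometry_right]
  exact h _ (normals_map (W.inv_mem hw) hv)

lemma isClassMap_imClass : IsClassMap W (imClass W) where
  mem_of_sign _ _ h v hv := (h v hv).2
  eq_of_mem z z' h := by
    simp only [imClass, faceOf_eq_of_mem h]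
  map_mem w hw z z' h := faceOf_map hw h

lemma isClassMap_cellClass : IsClassMap W (cellClass W) where
  mem_of_sign _ _ h := ⟨fun v hv => (h v hv).2, fun v hv _ => (h v hv).1⟩
  eq_of_mem z z' h := by
    ext z''
    simp only [cellClass, faceOf_eq_of_mem h.1, Set.mem_ofPred_eq]
    refine and_congr_right fun _ => forall₂_congr fun v hv => ?_
    rw [eq_zero_iff_of_sign_eq (h.1 v hv)]
    exact forall_congr' fun h0 => by rw [h.2 v hv h0]
  map_mem w hw z z' h := by
    refine ⟨faceOf_map hw h.1, fun v hv => ?_⟩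
    simp only [Prod.map_fst, Prod.map_snd, inner_isometry_right]
    exact h.2 _ (normals_map (W.inv_mem hw) hv)

lemma isClassMap_flatClass : IsClassMap W (flatClass W) where
  mem_of_sign _ _ h v hv :=
    and_congr (eq_zero_iff_of_sign_eq (h v hv).1) (eq_zero_iff_of_sign_eq (h v hv).2)
  eq_of_mem z z' h := by
    ext z''
    exact forall₂_congr fun v hv => by rw [h v hv]
  map_mem w hw z z' h v hv := by
    simp only [Prod.map_fst, Prod.map_snd, inner_isometry_right]
    exact h _ (normals_map (W.inv_mem hw) hv)

lemma IsClassMap.swap (hK : IsClassMap W K) : IsClassMap W (swapClass K) where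
  mem_of_sign _ _ h := hK.mem_of_sign _ _ fun v hv => (h v hv).symm
  eq_of_mem z z' h := by
    ext z''
    simp only [swapClass, hK.eq_of_mem _ _ h]
  map_mem w hw z z' h := hK.map_mem w hw _ _ h

lemma imageFamily_tau (K : Complexified V → Set (Complexified V)) :
    imageFamily (tau W) (family W K) = family W (swapClass K) := by
  have h : ∀ z : Complexified V, tau W '' (proj W '' K z) = proj W '' swapClass K z.swap := by
    intro z
    ext q
    constructor
    · rintro ⟨_, ⟨z', hz', rfl⟩, rfl⟩
      exact ⟨z'.swap, hz', rfl⟩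
    · rintro ⟨z', hz', rfl⟩
      exact ⟨_, ⟨z'.swap, hz', rfl⟩, rfl⟩
  ext B
  constructor
  · rintro ⟨_, ⟨z, rfl⟩, rfl⟩
    exact ⟨z.swap, (h z).symm⟩
  · rintro ⟨z, rfl⟩
    exact ⟨_, ⟨z.swap, rfl⟩, (h z.swap).symm⟩

lemma cellClass_subset_imClass (z : Complexified V) : cellClass W z ⊆ imClass W z :=
  fun _ h => h.1

/-- The face of y decides whether a normal vanishes at y, and exactly in that case the cell also
records its sign at x. -/
lemma cellClass_subset_flatClass (z : Complexified V) : cellClass W z ⊆ flatClass W z := by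
  intro z' h v hv
  rw [and_comm, eq_zero_iff_of_sign_eq (h.1 v hv), and_comm (b := inner ℝ v z.2 = 0)]
  exact and_congr_right fun h0 => eq_zero_iff_of_sign_eq (h.2 v hv h0)

lemma swapClass_cellClass_subset_flatClass (z : Complexified V) :
    swapClass (cellClass W) z ⊆ flatClass W z := by
  intro z' h v hv
  have := cellClass_subset_flatClass _ h v hv
  rwa [and_comm, and_comm (a := inner ℝ v z.1 = 0)]

end Classes

/-! ### Identification of the three stratifications with families of classes. -/

section Strata

variable {V : Type u} [NormedAddCommGroup V] [InnerProductSpace ℝ V]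
  {W : Subgroup (V ≃ₗᵢ[ℝ] V)}

/-- The restriction to faces of the dominant chamber loses nothing, because every W-orbit meets the
closed chamber. -/
lemma SIm_eq_family (hfin : Finite W) {C : Set V} (hC : IsChamber W C) :
    SIm W C = family W (imClass W) := by
  obtain ⟨x₀, hx₀, rfl⟩ := hC.exists_eq_faceOf
  have key : ∀ z : Complexified V,
      imMap W ⁻¹' (realProj W '' faceOf W z.2) = proj W '' imClass W z := by
    intro z
    ext q
    obtain ⟨z', rfl⟩ := proj_surjective q
    rw [isClassMap_imClass.proj_mem_iff]
    constructor
    · rintro ⟨y, hy, h⟩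
      obtain ⟨w, hw, hwy⟩ := (Quotient.eq (r := realSetoid W)).1 h
      exact ⟨w, hw, show z'.2 ∈ _ from hwy ▸ faceOf_map hw hy⟩
    · rintro ⟨w, hw, h⟩
      refine ⟨w⁻¹ z'.2, ?_, Quotient.sound (s := realSetoid W) ⟨w, hw, w.apply_symm_apply z'.2⟩⟩
      have h1 := faceOf_map (W.inv_mem hw) h
      have h2 : w⁻¹ (w z.2) = z.2 := w.symm_apply_apply z.2
      rwa [Prod.map_snd, h2] at h1
  ext X
  constructor
  · rintro ⟨_, ⟨y, rfl⟩, _, rfl⟩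
    exact ⟨(0, y), (key (0, y)).symm⟩
  · rintro ⟨z, rfl⟩
    obtain ⟨w, hw, hpos⟩ := exists_map_mem_closedChamber hfin x₀ z.2
    refine ⟨_, ⟨w z.2, rfl⟩, ?_, ?_⟩
    · rw [faceOf_subset_closure_iff]
      intro v hv hne
      obtain ⟨c, hc, v', hv', rfl⟩ := exists_unitNormal hv
      rw [real_inner_smul_left] at hne
      rw [sign_inner_smul hc, sign_inner_smul hc]
      have hreg : IsRegular W x₀ := fun v hv => hx₀ v hv.1
      have hne' := right_ne_zero_of_mul hne
      by_cases h : 0 < (inner ℝ v' x₀ : ℝ)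
      · rw [sign_pos h, sign_pos (lt_of_le_of_ne (hpos v' ⟨hv', h⟩) hne'.symm)]
      · have h1 := hreg.neg_mem hv' h
        have h2 := hpos _ h1
        have h3 := h1.2
        rw [inner_neg_left] at h2 h3
        rw [sign_neg (lt_of_le_of_ne (neg_nonneg.1 h2) hne'), sign_neg (neg_pos.1 h3)]
    · exact (isClassMap_imClass.image_map hw z).symm.trans (key (Prod.map w w z)).symm

/-- Translating x by the span of C leaves its signs unchanged on the hyperplanes containing C; on
the others C ≤ D already fixes the signs of D. Thus only the former signs matter, and every class
has the form [C, D] with C the face of y and D the face of x + s y, s large. -/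
lemma S1_eq_family (hfin : Finite W) : S1 W = family W (cellClass W) := by
  have key : ∀ c d : V, faceOf W c ⊆ closure (faceOf W d) →
      cell (faceOf W c) (faceOf W d) = cellClass W (d, c) := by
    intro c d hcd
    rw [faceOf_subset_closure_iff] at hcd
    ext z
    constructor
    · rintro ⟨hy, d', hd', hspan⟩
      refine ⟨hy, fun v hv h0 => ?_⟩
      have h1 : Submodule.span ℝ (faceOf W c) ≤ (ℝ ∙ v)ᗮ := by
        rw [Submodule.span_le]
        intro y hy
        exact mem_hyperplane_iff.2 ((eq_zero_iff_of_sign_eq (hy v hv)).2 h0)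
      have h2 := mem_hyperplane_iff.1 (h1 hspan)
      rw [inner_sub_right, sub_eq_zero] at h2
      rw [h2, hd' v hv]
    · rintro ⟨hy, hx⟩
      -- The required element of D is x + s y: off the hyperplanes through y it takes the signs of
      -- y, and on them it keeps those of x.
      obtain ⟨s, hs, hsign⟩ := exists_sign_add_smul (W := W) hfin z.1 z.2
      refine ⟨hy, z.1 + s • z.2, fun v hv => ?_, ?_⟩
      · by_cases h0 : (inner ℝ v c : ℝ) = 0
        · have h1 := (eq_zero_iff_of_sign_eq (hy v hv)).2 h0
          rw [inner_add_right, real_inner_smul_right, h1, mul_zero, add_zero, hx v hv h0]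
        · rw [hsign v hv (fun h => h0 ((eq_zero_iff_of_sign_eq (hy v hv)).1 h)), hy v hv,
            hcd v hv h0]
      · have : z.1 - (z.1 + s • z.2) = (-s) • z.2 := by module
        rw [this]
        exact Submodule.smul_mem _ _ (Submodule.subset_span hy)
  ext X
  constructor
  · rintro ⟨_, ⟨c, rfl⟩, _, ⟨d, rfl⟩, hcd, rfl⟩
    exact ⟨(d, c), by rw [key c d hcd]⟩
  · rintro ⟨z, rfl⟩
    obtain ⟨s, hs, hsign⟩ := exists_sign_add_smul (W := W) hfin z.1 z.2
    have hcd : faceOf W z.2 ⊆ closure (faceOf W (z.1 + s • z.2)) := by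
      rw [faceOf_subset_closure_iff]
      exact fun v hv hne => (hsign v hv hne).symm
    refine ⟨_, ⟨z.2, rfl⟩, _, ⟨z.1 + s • z.2, rfl⟩, hcd, ?_⟩
    rw [key _ _ hcd]
    show proj W '' _ = _
    rw [isClassMap_cellClass.eq_of_mem (z.1 + s • z.2, z.2) z
      ⟨mem_faceOf_self _, fun v hv h0 => ?_⟩]
    have h0 : (inner ℝ v z.2 : ℝ) = 0 := h0
    rw [inner_add_right, real_inner_smul_right, h0, mul_zero, add_zero]

/-- Every subspace has a point which lies in no reflection hyperplane other than those that
contain the subspace. -/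
lemma exists_generic (hfin : Finite W) (L : Submodule ℝ V) :
    ∃ g ∈ L, ∀ v ∈ normals W, (inner ℝ v g : ℝ) = 0 → ∀ x ∈ L, (inner ℝ v x : ℝ) = 0 := by
  classical
  have hP := finite_unitNormals hfin
  let s : Finset (Subspace ℝ L) :=
    (hP.toFinset.image fun v => ((ℝ ∙ v)ᗮ).comap L.subtype).filter (· ≠ ⊤)
  have hs : ⊤ ∉ s := by simp [s]
  -- A real vector space is not a finite union of proper subspaces; here these are the proper traces
  -- on L of the hyperplanes.
  obtain ⟨g, hg⟩ := (Set.ne_univ_iff_exists_notMem _).1 (Subspace.biUnion_ne_univ_of_top_notMem hs)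
  refine ⟨g, g.2, fun v hv h0 x hx => ?_⟩
  obtain ⟨c, hc, v', hv', rfl⟩ := exists_unitNormal hv
  rw [real_inner_smul_left, mul_eq_zero, or_iff_right hc.ne'] at h0 ⊢
  by_contra hne
  refine hg (Set.mem_biUnion (x := ((ℝ ∙ v')ᗮ).comap L.subtype) ?_ ?_)
  · simp only [s, Finset.coe_filter, Set.mem_ofPred_eq, Finset.mem_image]
    refine ⟨⟨v', hP.mem_toFinset.2 hv', rfl⟩, fun htop => hne ?_⟩
    have : (⟨x, hx⟩ : L) ∈ ((ℝ ∙ v')ᗮ).comap L.subtype := htop ▸ Submodule.mem_top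
    exact mem_hyperplane_iff.1 this
  · exact mem_hyperplane_iff.2 h0

/-- The smallest flat whose complexification contains `z`. -/
def flatOf (W : Subgroup (V ≃ₗᵢ[ℝ] V)) (z : Complexified V) : Submodule ℝ V :=
  sInf {H ∈ hyperplanes W | z.1 ∈ H ∧ z.2 ∈ H}

lemma mem_flatOf_iff {z : Complexified V} {x : V} : x ∈ flatOf W z ↔
    ∀ v ∈ normals W, (inner ℝ v z.1 : ℝ) = 0 → (inner ℝ v z.2 : ℝ) = 0 →
      (inner ℝ v x : ℝ) = 0 := by
  rw [flatOf, Submodule.mem_sInf]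
  constructor
  · intro h v hv h1 h2
    exact mem_hyperplane_iff.1 (h _ ⟨⟨v, hv, rfl⟩, mem_hyperplane_iff.2 h1,
      mem_hyperplane_iff.2 h2⟩)
  · rintro h _ ⟨⟨v, hv, rfl⟩, h1, h2⟩
    exact mem_hyperplane_iff.2 (h v hv (mem_hyperplane_iff.1 h1) (mem_hyperplane_iff.1 h2))

lemma fst_mem_flatOf (z : Complexified V) : z.1 ∈ flatOf W z :=
  mem_flatOf_iff.2 fun _ _ h _ => h

lemma snd_mem_flatOf (z : Complexified V) : z.2 ∈ flatOf W z :=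
  mem_flatOf_iff.2 fun _ _ _ h => h

/-- A point of the generic part lies in exactly the complexified hyperplanes containing L, and these
recover L because a flat is an intersection of hyperplanes. -/
lemma genericPart_eq_flatClass {L : Submodule ℝ V} (hL : L ∈ flats W) {z : Complexified V}
    (hz : z ∈ genericPart W L) : genericPart W L = flatClass W z := by
  obtain ⟨A, hA, rfl⟩ := hL
  have hle : ∀ z ∈ genericPart W (sInf A), ∀ v ∈ normals W,
      ((inner ℝ v z.1 : ℝ) = 0 ∧ (inner ℝ v z.2 : ℝ) = 0) ↔ sInf A ≤ (ℝ ∙ v)ᗮ := by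
    intro z hz v hv
    constructor
    · intro h
      by_contra hcon
      exact hz.2 _ ⟨v, hv, rfl⟩ hcon ⟨mem_hyperplane_iff.2 h.1, mem_hyperplane_iff.2 h.2⟩
    · intro h
      exact ⟨mem_hyperplane_iff.1 (h hz.1.1), mem_hyperplane_iff.1 (h hz.1.2)⟩
  ext z'
  constructor
  · intro hz' v hv
    rw [hle z hz v hv, hle z' hz' v hv]
  · intro hz'
    have hv' : ∀ v ∈ normals W,
        ((inner ℝ v z'.1 : ℝ) = 0 ∧ (inner ℝ v z'.2 : ℝ) = 0) ↔ sInf A ≤ (ℝ ∙ v)ᗮ :=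
      fun v hv => (hz' v hv).trans (hle z hz v hv)
    refine ⟨?_, ?_⟩
    · simp only [Submodule.mem_sInf]
      constructor <;> intro H hH <;> obtain ⟨v, hv, rfl⟩ := hA hH
      · exact mem_hyperplane_iff.2 ((hv' v hv).2 (sInf_le hH)).1
      · exact mem_hyperplane_iff.2 ((hv' v hv).2 (sInf_le hH)).2
    · rintro _ ⟨v, hv, rfl⟩ hnle ⟨h1, h2⟩
      exact hnle ((hv' v hv).1 ⟨mem_hyperplane_iff.1 h1, mem_hyperplane_iff.1 h2⟩)

lemma S0_eq_family (hfin : Finite W) : S0 W = family W (flatClass W) := by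
  ext X
  constructor
  · rintro ⟨L, hL, rfl⟩
    obtain ⟨g, hg, hgen⟩ := exists_generic (W := W) hfin L
    refine ⟨(g, g), ?_⟩
    show _ '' _ = _
    rw [genericPart_eq_flatClass hL (z := (g, g))]
    refine ⟨⟨hg, hg⟩, ?_⟩
    rintro _ ⟨v, hv, rfl⟩ hnle ⟨h1, -⟩
    exact hnle fun x hx => mem_hyperplane_iff.2 (hgen v hv (mem_hyperplane_iff.1 h1) x hx)
  · rintro ⟨z, rfl⟩
    have hL : flatOf W z ∈ flats W := ⟨_, fun H hH => hH.1, rfl⟩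
    refine ⟨_, hL, ?_⟩
    rw [genericPart_eq_flatClass hL (z := z)]
    refine ⟨⟨fst_mem_flatOf z, snd_mem_flatOf z⟩, ?_⟩
    intro H hH hnle hmem
    exact hnle (sInf_le ⟨hH, hmem⟩)

end Strata

/-! ### Topology of the quotient; the meet and join identities. -/

section Quotient

open Filter Topology

variable {V : Type u} [NormedAddCommGroup V] [InnerProductSpace ℝ V]
  {W : Subgroup (V ≃ₗᵢ[ℝ] V)}

lemma proj_mem_image_iff {O : Set (Complexified V)} {z : Complexified V} :
    proj W z ∈ proj W '' O ↔ ∃ w ∈ W, Prod.map w w z ∈ O := by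
  constructor
  · rintro ⟨z', hz', h⟩
    obtain ⟨w, hw, rfl⟩ := proj_eq_iff.1 h.symm
    exact ⟨w, hw, hz'⟩
  · rintro ⟨w, hw, h⟩
    exact ⟨_, h, (proj_eq_iff.2 ⟨w, hw, rfl⟩).symm⟩

lemma continuous_map_isometry (w : V ≃ₗᵢ[ℝ] V) :
    Continuous fun z : Complexified V => Prod.map w w z :=
  w.continuous.prodMap w.continuous

lemma isOpenMap_proj : IsOpenMap (proj W) := by
  intro O hO
  refine isOpen_coinduced.2 ?_
  have : proj W ⁻¹' (proj W '' O) = ⋃ w ∈ W, (fun z => Prod.map w w z) ⁻¹' O := by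
    ext z
    rw [Set.mem_preimage, proj_mem_image_iff]
    simp
  change IsOpen (proj W ⁻¹' (proj W '' O))
  rw [this]
  exact isOpen_biUnion fun w _ => hO.preimage (continuous_map_isometry w)

/-- If every translate of z avoids the closure of K, finiteness of W gives one open neighbourhood of
z all of whose translates avoid it, and its image is open. -/
lemma exists_mem_closure (hfin : Finite W) {K : Set (Complexified V)} {z : Complexified V}
    (hz : proj W z ∈ closure (proj W '' K)) : ∃ w ∈ W, Prod.map w w z ∈ closure K := by
  by_contra! hcon
  have hWf : (W : Set (V ≃ₗᵢ[ℝ] V)).Finite := Set.toFinite _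
  have hO : IsOpen (⋂ w ∈ (W : Set (V ≃ₗᵢ[ℝ] V)), (fun z => Prod.map w w z) ⁻¹' (closure K)ᶜ) :=
    hWf.isOpen_biInter fun w _ => isClosed_closure.isOpen_compl.preimage (continuous_map_isometry w)
  obtain ⟨_, ⟨z', hz', rfl⟩, k, hk, h⟩ := mem_closure_iff.1 hz _ (isOpenMap_proj _ hO)
    ⟨z, Set.mem_iInter₂.2 hcon, rfl⟩
  obtain ⟨w, hw, rfl⟩ := proj_eq_iff.1 h.symm
  exact Set.mem_iInter₂.1 hz' w hw (subset_closure hk)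

/-- In the quotient a set of normals is only defined up to W, but its cardinality is well defined.
This is the invariant by which strata are compared. -/
lemma ncard_unitNormals_map {p : V → Complexified V → Prop}
    (hp : ∀ w ∈ W, ∀ v z, p (w v) (Prod.map w w z) ↔ p v z) {w : V ≃ₗᵢ[ℝ] V} (hw : w ∈ W)
    (z : Complexified V) :
    {v ∈ unitNormals W | p v (Prod.map w w z)}.ncard = {v ∈ unitNormals W | p v z}.ncard := by
  rw [← Set.ncard_image_of_injective {v ∈ unitNormals W | p v z} w.injective]
  congr 1
  ext v
  constructor
  · rintro ⟨hv, h⟩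
    refine ⟨w⁻¹ v, ⟨unitNormals_map (W.inv_mem hw) hv, ?_⟩, w.apply_symm_apply v⟩
    rw [← hp w hw, show w (w⁻¹ v) = v from w.apply_symm_apply v]
    exact h
  · rintro ⟨v, ⟨hv, h⟩, rfl⟩
    exact ⟨unitNormals_map hw hv, (hp w hw _ _).2 h⟩

lemma ncard_eq_of_proj_mem_imClass {z z' : Complexified V}
    (h : proj W z' ∈ proj W '' imClass W z) :
    {v ∈ unitNormals W | (inner ℝ v z'.2 : ℝ) = 0}.ncard =
      {v ∈ unitNormals W | (inner ℝ v z.2 : ℝ) = 0}.ncard := by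
  obtain ⟨w, hw, h⟩ := isClassMap_imClass.proj_mem_iff.1 h
  rw [← ncard_unitNormals_map (p := fun v z => (inner ℝ v z.2 : ℝ) = 0)
    (fun w _ v z => by simp) hw z]
  congr 1
  ext v
  exact and_congr_right fun hv => eq_zero_iff_of_sign_eq (h v hv.1)

lemma ncard_eq_of_proj_mem_flatClass {z z' : Complexified V}
    (h : proj W z' ∈ proj W '' flatClass W z) :
    {v ∈ unitNormals W | (inner ℝ v z'.1 : ℝ) = 0 ∧ (inner ℝ v z'.2 : ℝ) = 0}.ncard =
      {v ∈ unitNormals W | (inner ℝ v z.1 : ℝ) = 0 ∧ (inner ℝ v z.2 : ℝ) = 0}.ncard := by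
  obtain ⟨w, hw, h⟩ := isClassMap_flatClass.proj_mem_iff.1 h
  rw [← ncard_unitNormals_map (p := fun v z => (inner ℝ v z.1 : ℝ) = 0 ∧ (inner ℝ v z.2 : ℝ) = 0)
    (fun w _ v z => by simp) hw z]
  congr 1
  ext v
  exact and_congr_right fun hv => h v hv.1

lemma mem_cellClass_of_unitNormals {z z' : Complexified V}
    (h : ∀ v ∈ unitNormals W,
      SignType.sign (inner ℝ v z'.2 : ℝ) = SignType.sign (inner ℝ v z.2 : ℝ))
    (h' : ∀ v ∈ unitNormals W, (inner ℝ v z.2 : ℝ) = 0 →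
      SignType.sign (inner ℝ v z'.1 : ℝ) = SignType.sign (inner ℝ v z.1 : ℝ)) :
    z' ∈ cellClass W z := by
  constructor
  · intro v hv
    obtain ⟨c, hc, v', hv', rfl⟩ := exists_unitNormal hv
    rw [sign_inner_smul hc, sign_inner_smul hc, h v' hv']
  · intro v hv h0
    obtain ⟨c, hc, v', hv', rfl⟩ := exists_unitNormal hv
    rw [sign_inner_smul hc, sign_inner_smul hc]
    rw [real_inner_smul_left, mul_eq_zero, or_iff_right hc.ne'] at h0
    exact h' v' hv' h0

/-- A cell is closed in the intersection of a stratum of the imaginary decomposition with a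
stratum of the flat decomposition. -/
lemma mem_cellClass_of_mem_closure (hfin : Finite W) {z₁ z₂ : Complexified V}
    (h : z₁ ∈ closure (cellClass W z₂)) (hIm : proj W z₁ ∈ proj W '' imClass W z₂)
    (h0 : proj W z₁ ∈ proj W '' flatClass W z₂) : z₁ ∈ cellClass W z₂ := by
  have hfr := mem_closure_iff_frequently.1 h
  have hy : ∀ v ∈ normals W, (inner ℝ v z₁.2 : ℝ) ≠ 0 →
      SignType.sign (inner ℝ v z₁.2 : ℝ) = SignType.sign (inner ℝ v z₂.2 : ℝ) := by
    intro v hv hne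
    obtain ⟨z, hz, hz'⟩ := (hfr.and_eventually
      (continuous_snd.continuousAt.eventually (eventually_sign_inner_eq v hne))).exists
    rw [← hz', hz.1 v hv]
  have hx : ∀ v ∈ normals W, (inner ℝ v z₂.2 : ℝ) = 0 → (inner ℝ v z₁.1 : ℝ) ≠ 0 →
      SignType.sign (inner ℝ v z₁.1 : ℝ) = SignType.sign (inner ℝ v z₂.1 : ℝ) := by
    intro v hv h0 hne
    obtain ⟨z, hz, hz'⟩ := (hfr.and_eventually
      (continuous_fst.continuousAt.eventually (eventually_sign_inner_eq v hne))).exists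
    rw [← hz', hz.2 v hv h0]
  have hy0 : ∀ v ∈ normals W, (inner ℝ v z₂.2 : ℝ) = 0 → (inner ℝ v z₁.2 : ℝ) = 0 := by
    intro v hv h0
    by_contra hne
    exact hne ((eq_zero_iff_of_sign_eq (hy v hv hne)).2 h0)
  have hΦ := finite_unitNormals hfin
  -- The limit z₁ has at least the zeros of z₂; lying in the same strata, it has equally many, so
  -- the inclusions are equalities.
  have e1 := Set.eq_of_subset_of_ncard_le (s := {v ∈ unitNormals W | (inner ℝ v z₂.2 : ℝ) = 0})
    (t := {v ∈ unitNormals W | (inner ℝ v z₁.2 : ℝ) = 0})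
    (fun v hv => ⟨hv.1, hy0 v hv.1.1 hv.2⟩) (ncard_eq_of_proj_mem_imClass hIm).le
    (hΦ.subset fun v hv => hv.1)
  have e2 := Set.eq_of_subset_of_ncard_le
    (s := {v ∈ unitNormals W | (inner ℝ v z₂.1 : ℝ) = 0 ∧ (inner ℝ v z₂.2 : ℝ) = 0})
    (t := {v ∈ unitNormals W | (inner ℝ v z₁.1 : ℝ) = 0 ∧ (inner ℝ v z₁.2 : ℝ) = 0})
    (fun v hv => ⟨hv.1, by
      by_contra hne
      exact hne ((eq_zero_iff_of_sign_eq (hx v hv.1.1 hv.2.2 hne)).2 hv.2.1),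
      hy0 v hv.1.1 hv.2.2⟩) (ncard_eq_of_proj_mem_flatClass h0).le
    (hΦ.subset fun v hv => hv.1)
  refine mem_cellClass_of_unitNormals (fun v hv => ?_) (fun v hv hv0 => ?_)
  · by_cases hne : (inner ℝ v z₁.2 : ℝ) = 0
    · have : v ∈ {v ∈ unitNormals W | (inner ℝ v z₂.2 : ℝ) = 0} := e1 ▸ ⟨hv, hne⟩
      rw [hne, this.2]
    · exact hy v hv.1 hne
  · by_cases hne : (inner ℝ v z₁.1 : ℝ) = 0
    · have : v ∈ {v ∈ unitNormals W | (inner ℝ v z₂.1 : ℝ) = 0 ∧ (inner ℝ v z₂.2 : ℝ) = 0} :=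
        e2 ▸ ⟨hv, hne, hy0 v hv.1 hv0⟩
      rw [hne, this.2.1]
    · exact hx v hv.1 hv0 hne

lemma convex_cellClass (z : Complexified V) : Convex ℝ (cellClass W z) := by
  have : cellClass W z = (LinearMap.snd ℝ V V) ⁻¹' faceOf W z.2 ∩
      ⋂ v ∈ {v ∈ normals W | (inner ℝ v z.2 : ℝ) = 0}, (LinearMap.fst ℝ V V) ⁻¹'
        {x : V | SignType.sign (inner ℝ v x : ℝ) = SignType.sign (inner ℝ v z.1 : ℝ)} := by
    ext z'
    simp [cellClass]
  rw [this]
  exact ((convex_faceOf _).linear_preimage _).inter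
    (convex_iInter₂ fun v _ => (convex_sign_inner v _).linear_preimage _)

lemma isPreconnected_proj_cellClass (z : Complexified V) :
    IsPreconnected (proj W '' cellClass W z) :=
  (convex_cellClass z).isPreconnected.image _ continuous_proj.continuousOn

lemma connectedComponentIn_inter (hfin : Finite W) (z : Complexified V) :
    connectedComponentIn (proj W '' imClass W z ∩ proj W '' flatClass W z) (proj W z) =
      proj W '' cellClass W z := by
  set A := proj W '' imClass W z
  set B := proj W '' flatClass W z
  have hA : A ∈ family W (imClass W) := ⟨z, rfl⟩
  have hB : B ∈ family W (flatClass W) := ⟨z, rfl⟩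
  refine Set.Subset.antisymm ?_ ?_
  · by_contra hcon
    obtain ⟨q, hq, hqz⟩ := Set.not_subset.1 hcon
    set Q := connectedComponentIn (A ∩ B) (proj W z)
    have hQ : Q ⊆ A ∩ B := connectedComponentIn_subset _ _
    have hzQ : proj W z ∈ Q := mem_connectedComponentIn
      ⟨isClassMap_imClass.proj_mem z, isClassMap_flatClass.proj_mem z⟩
    have hfam := isClassMap_cellClass.finite_family hfin
    -- Each cell meeting A ∩ B is closed in it. A component leaving the cell of z would be covered
    -- by the closure of that cell and the finite union of the closures of the others, which do not
    -- meet inside A ∩ B.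
    have hclosed : ∀ S ∈ family W (cellClass W), ∀ q ∈ A ∩ B, q ∈ closure S →
        (S ∩ (A ∩ B)).Nonempty → q ∈ S := by
      rintro _ ⟨z', rfl⟩ q hqAB hqS ⟨_, ⟨z₂, hz₂, rfl⟩, hz₂A, hz₂B⟩
      obtain ⟨z₁, rfl⟩ := proj_surjective q
      obtain ⟨w, hw, hcl⟩ := exists_mem_closure hfin hqS
      have hq : proj W z₁ = proj W (Prod.map w w z₁) := proj_eq_iff.2 ⟨w, hw, rfl⟩
      have e := isClassMap_cellClass.eq_of_mem _ _ hz₂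
      rw [isClassMap_imClass.eq_image hA hz₂A, isClassMap_flatClass.eq_image hB hz₂B, hq] at hqAB
      change proj W z₁ ∈ proj W '' cellClass W z'
      rw [← e, hq]
      exact ⟨_, mem_cellClass_of_mem_closure hfin (e ▸ hcl) hqAB.1 hqAB.2, rfl⟩
    obtain ⟨q', hq'Q, hq'1, hq'2⟩ := isPreconnected_closed_iff.1 isPreconnected_connectedComponentIn
      (closure (proj W '' cellClass W z))
      (⋃ S ∈ {S ∈ family W (cellClass W) | S ≠ proj W '' cellClass W z ∧ (S ∩ (A ∩ B)).Nonempty},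
        closure S) isClosed_closure
      ((hfam.subset fun S hS => hS.1).isClosed_biUnion fun S _ => isClosed_closure)
      (by
        intro q hq
        obtain ⟨z', rfl⟩ := proj_surjective q
        by_cases h : proj W '' cellClass W z' = proj W '' cellClass W z
        · exact Or.inl (subset_closure (h ▸ isClassMap_cellClass.proj_mem z'))
        · exact Or.inr (Set.mem_biUnion (x := proj W '' cellClass W z')
            ⟨⟨z', rfl⟩, h, _, isClassMap_cellClass.proj_mem z', hQ hq⟩
            (subset_closure (isClassMap_cellClass.proj_mem z'))))
      ⟨_, hzQ, subset_closure (isClassMap_cellClass.proj_mem z)⟩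
      (by
        obtain ⟨z', rfl⟩ := proj_surjective q
        refine ⟨_, hq, Set.mem_biUnion (x := proj W '' cellClass W z')
            ⟨⟨z', rfl⟩, fun h => hqz (h ▸ isClassMap_cellClass.proj_mem z'), _,
              isClassMap_cellClass.proj_mem z', hQ hq⟩
            (subset_closure (isClassMap_cellClass.proj_mem z'))⟩)
    obtain ⟨S, ⟨hS, hne, hSAB⟩, hq'S⟩ := Set.mem_iUnion₂.1 hq'2
    have h1 := hclosed _ ⟨z, rfl⟩ q' (hQ hq'Q) hq'1
      ⟨_, isClassMap_cellClass.proj_mem z, hQ hzQ⟩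
    have h2 := hclosed S hS q' (hQ hq'Q) hq'S hSAB
    obtain ⟨z', rfl⟩ := proj_surjective q'
    exact hne ((isClassMap_cellClass.eq_image hS h2).trans (isClassMap_cellClass.image_eq h1))
  · exact (isPreconnected_proj_cellClass z).subset_connectedComponentIn
      (isClassMap_cellClass.proj_mem z) (Set.subset_inter
        (Set.image_mono (cellClass_subset_imClass z))
        (Set.image_mono (cellClass_subset_flatClass z)))

lemma family_cellClass_eq_wedge (hfin : Finite W) : family W (cellClass W) =
    wedge (family W (imClass W)) (family W (flatClass W)) := by
  ext X
  constructor
  · rintro ⟨z, rfl⟩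
    exact ⟨_, ⟨z, rfl⟩, _, ⟨z, rfl⟩, proj W z, ⟨isClassMap_imClass.proj_mem z,
      isClassMap_flatClass.proj_mem z⟩, (connectedComponentIn_inter hfin z).symm⟩
  · rintro ⟨A, hA, B, hB, q, ⟨hqA, hqB⟩, rfl⟩
    obtain ⟨z, rfl⟩ := proj_surjective q
    rw [isClassMap_imClass.eq_image hA hqA, isClassMap_flatClass.eq_image hB hqB,
      connectedComponentIn_inter hfin]
    exact ⟨z, rfl⟩

lemma family_flatClass_eq_vee (hfin : Finite W) : family W (flatClass W) =
    vee (family W (cellClass W)) (family W (swapClass (cellClass W))) := by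
  set r : ComplexQuotient W → ComplexQuotient W → Prop := fun a b =>
    (∃ A ∈ family W (cellClass W), a ∈ A ∧ b ∈ A) ∨
      (∃ B ∈ family W (swapClass (cellClass W)), a ∈ B ∧ b ∈ B) with hr
  have hswap : IsClassMap W (swapClass (cellClass W)) := isClassMap_cellClass.swap
  have hstep : ∀ z z' : Complexified V, z' ∈ cellClass W z →
      Relation.EqvGen r (proj W z) (proj W z') := fun z z' h =>
    .rel _ _ (Or.inl ⟨_, ⟨z, rfl⟩, isClassMap_cellClass.proj_mem z, ⟨z', h, rfl⟩⟩)
  have hstep' : ∀ z z' : Complexified V, z' ∈ swapClass (cellClass W) z →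
      Relation.EqvGen r (proj W z) (proj W z') := fun z z' h =>
    .rel _ _ (Or.inr ⟨_, ⟨z, rfl⟩, hswap.proj_mem z, ⟨z', h, rfl⟩⟩)
  -- Adding s y makes the real part generic in the smallest flat through z. The τ-cell then
  -- constrains the imaginary part only on hyperplanes containing that flat, so y may become g; with
  -- imaginary part g, the real part is equally free to become g.
  have hchain : ∀ (z : Complexified V) (g : V), (∀ v ∈ normals W, (inner ℝ v g : ℝ) = 0 ↔
      (inner ℝ v z.1 : ℝ) = 0 ∧ (inner ℝ v z.2 : ℝ) = 0) →
      Relation.EqvGen r (proj W z) (proj W (g, g)) := by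
    rintro ⟨x, y⟩ g hg
    obtain ⟨s, hs, hsign⟩ := exists_sign_add_smul (W := W) hfin x y
    have h0 : ∀ v, (inner ℝ v y : ℝ) = 0 → (inner ℝ v (x + s • y) : ℝ) = inner ℝ v x := by
      intro v h
      rw [inner_add_right, real_inner_smul_right, h, mul_zero, add_zero]
    have hzero : ∀ v ∈ normals W, (inner ℝ v (x + s • y) : ℝ) = 0 →
        (inner ℝ v x : ℝ) = 0 ∧ (inner ℝ v y : ℝ) = 0 := by
      intro v hv h
      by_cases hy : (inner ℝ v y : ℝ) = 0
      · exact ⟨h0 v hy ▸ h, hy⟩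
      · exact absurd ((eq_zero_iff_of_sign_eq (hsign v hv hy)).1 h) hy
    refine (hstep (x, y) (x + s • y, y) ⟨mem_faceOf_self y, fun v hv h => ?_⟩).trans _ _ _
      ((hstep' (x + s • y, y) (x + s • y, g) ⟨mem_faceOf_self (x + s • y),
        fun v hv h => ?_⟩).trans _ _ _
      (hstep (x + s • y, g) (g, g) ⟨mem_faceOf_self g, fun v hv h => ?_⟩))
    · show SignType.sign (inner ℝ v (x + s • y) : ℝ) = SignType.sign (inner ℝ v x : ℝ)
      rw [h0 v h]
    · have h1 := hzero v hv h
      show SignType.sign (inner ℝ v g : ℝ) = SignType.sign (inner ℝ v y : ℝ)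
      rw [(hg v hv).2 h1, h1.2]
    · have h1 := (hg v hv).1 h
      show SignType.sign (inner ℝ v g : ℝ) = SignType.sign (inner ℝ v (x + s • y) : ℝ)
      rw [(hg v hv).2 h1, h0 v h1.2, h1.1]
  have hinv : ∀ a b, Relation.EqvGen r a b → ∀ C ∈ family W (flatClass W), a ∈ C ↔ b ∈ C := by
    intro a b h C hC
    have hsub : ∀ {K}, IsClassMap W K → (∀ z, K z ⊆ flatClass W z) → ∀ A ∈ family W K,
        ∀ a ∈ A, a ∈ C → A ⊆ C := by
      intro K hK hle A hA a haA haC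
      obtain ⟨z, rfl⟩ := proj_surjective a
      rw [hK.eq_image hA haA, isClassMap_flatClass.eq_image hC haC]
      exact Set.image_mono (hle z)
    induction h with
    | rel a b h =>
      rcases h with ⟨A, hA, ha, hb⟩ | ⟨A, hA, ha, hb⟩
      · have := hsub isClassMap_cellClass cellClass_subset_flatClass A hA
        exact ⟨fun h => this a ha h hb, fun h => this b hb h ha⟩
      · have := hsub hswap swapClass_cellClass_subset_flatClass A hA
        exact ⟨fun h => this a ha h hb, fun h => this b hb h ha⟩
    | refl => rfl
    | symm _ _ _ ih => exact ih.symm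
    | trans _ _ _ _ _ ih ih' => exact ih.trans ih'
  have key : ∀ z, proj W '' flatClass W z = {q | Relation.EqvGen r (proj W z) q} := by
    intro z
    refine Set.Subset.antisymm ?_ ?_
    · rintro _ ⟨z', hz', rfl⟩
      -- Both z and z' lie in the same complexified hyperplanes, so a single g ends both chains.
      obtain ⟨g, hgL, hg⟩ := exists_generic (W := W) hfin (flatOf W z)
      have hg' : ∀ v ∈ normals W, (inner ℝ v g : ℝ) = 0 ↔
          (inner ℝ v z.1 : ℝ) = 0 ∧ (inner ℝ v z.2 : ℝ) = 0 := fun v hv =>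
        ⟨fun h => ⟨hg v hv h _ (fst_mem_flatOf z), hg v hv h _ (snd_mem_flatOf z)⟩,
          fun h => mem_flatOf_iff.1 hgL v hv h.1 h.2⟩
      exact (hchain z g hg').trans _ _ _
        (.symm _ _ (hchain z' g fun v hv => (hg' v hv).trans (hz' v hv).symm))
    · intro q hq
      exact (hinv _ _ hq _ ⟨z, rfl⟩).1 (isClassMap_flatClass.proj_mem z)
  ext X
  constructor
  · rintro ⟨z, rfl⟩
    exact ⟨proj W z, key z⟩
  · rintro ⟨q, rfl⟩
    obtain ⟨z, rfl⟩ := proj_surjective q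
    exact ⟨z, key z⟩

end Quotient

/-! ### Stabilizers of real and complexified points. -/

section Stabilizers

variable {V : Type u} [NormedAddCommGroup V] [InnerProductSpace ℝ V]
  {W : Subgroup (V ≃ₗᵢ[ℝ] V)}

/-- The stabilizer of a point is generated by reflections. -/
lemma mem_closure_of_map_eq (hW : IsFiniteReflectionGroup W) {w : V ≃ₗᵢ[ℝ] V} (hw : w ∈ W) {y : V}
    (hy : w y = y) : w ∈ Subgroup.closure (refl '' {v ∈ normals W | inner ℝ v y = 0}) := by
  -- Moving a regular point g far in the direction of y gives a regular point whose closed chamber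
  -- contains y, so `fundamental_domain` applies with w y = y.
  obtain ⟨g, -, hg⟩ := exists_generic (W := W) hW.1 ⊤
  obtain ⟨s, hs, hsign⟩ := exists_sign_add_smul (W := W) hW.1 g y
  have hreg : IsRegular W (g + s • y) := by
    intro v hv h
    by_cases h0 : (inner ℝ v y : ℝ) = 0
    · rw [inner_add_right, real_inner_smul_right, h0, mul_zero, add_zero] at h
      exact hv.1.1 (inner_self_eq_zero.1 (hg v hv.1 h v Submodule.mem_top))
    · exact h0 ((eq_zero_iff_of_sign_eq (hsign v hv.1 h0)).1 h)
  have hpos : ∀ v ∈ positiveNormals W (g + s • y), 0 ≤ (inner ℝ v y : ℝ) := by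
    intro v hv
    by_cases h0 : (inner ℝ v y : ℝ) = 0
    · exact h0.ge
    · have h1 := hsign v hv.1.1 h0
      rw [sign_pos hv.2] at h1
      exact (sign_eq_one_iff.1 h1.symm).le
  exact (fundamental_domain hW hreg hw hpos (by rw [hy]; exact hpos)).2

/-- An isometry in `W` which fixes a point of the complexification fixes the smallest flat whose
complexification contains this point. -/
lemma map_eq_of_mem_flatOf (hW : IsFiniteReflectionGroup W) {w : V ≃ₗᵢ[ℝ] V} (hw : w ∈ W)
    {z : Complexified V} (hz : Prod.map w w z = z) {x : V} (hx : x ∈ flatOf W z) : w x = x := by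
  obtain ⟨h1, h2⟩ := Prod.ext_iff.1 hz
  -- The stabilizer theorem is used twice: w fixes the imaginary part, so it lies in the reflection
  -- group W'; inside W' it fixes the real part, so it is a product of reflections whose normals are
  -- orthogonal to both parts.
  set W' := Subgroup.closure (refl '' {v ∈ normals W | inner ℝ v z.2 = 0}) with hW'
  have hle : W' ≤ W := by
    rw [hW', Subgroup.closure_le]
    rintro _ ⟨v, hv, rfl⟩
    exact hv.1.2
  have hfix : ∀ {S : Set V} {x : V}, (∀ v ∈ S, (inner ℝ v x : ℝ) = 0) →
      ∀ w ∈ Subgroup.closure (refl '' S), w x = x := by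
    intro S x hS w hw
    induction hw using Subgroup.closure_induction with
    | mem w hw =>
      obtain ⟨v, hv, rfl⟩ := hw
      exact refl_eq_self_iff.2 (hS v hv)
    | one => rfl
    | mul a b _ _ ha hb => rw [show (a * b) x = a (b x) from rfl, hb, ha]
    | inv a _ ha =>
      nth_rewrite 1 [← ha]
      exact a.symm_apply_apply x
  have hnormals : ∀ v ∈ normals W', v ∈ normals W ∧ (inner ℝ v z.2 : ℝ) = 0 := fun v hv =>
    ⟨⟨hv.1, hle hv.2⟩, refl_eq_self_iff.1 (hfix (fun v hv => hv.2) _ hv.2)⟩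
  have hrefl : IsFiniteReflectionGroup W' := by
    have := hW.1
    refine ⟨Finite.of_injective _ (Subgroup.inclusion_injective hle), le_antisymm ?_ ?_⟩
    · conv_lhs => rw [hW']
      rw [Subgroup.closure_le]
      rintro _ ⟨v, hv, rfl⟩
      exact Subgroup.subset_closure ⟨v, ⟨hv.1.1, Subgroup.subset_closure ⟨v, hv, rfl⟩⟩, rfl⟩
    · rw [Subgroup.closure_le]
      rintro _ ⟨v, hv, rfl⟩
      exact hv.2
  refine hfix (fun v hv => ?_) w (mem_closure_of_map_eq hrefl (mem_closure_of_map_eq hW hw h2) h1)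
  obtain ⟨h3, h4⟩ := hnormals v hv.1
  exact mem_flatOf_iff.1 hx v h3 hv.2 h4

end Stabilizers

/-! ### Local structure of a flat stratum in the quotient. -/

section Boxes

open Filter Topology

variable {V : Type u} [NormedAddCommGroup V] [InnerProductSpace ℝ V]
  {W : Subgroup (V ≃ₗᵢ[ℝ] V)}

/-- The radius `ε` is so small that no hyperplane comes between the centre of the ball and another
of its points, and that only isometries which fix the centre map a point of the ball into it. -/
structure IsSmall (W : Subgroup (V ≃ₗᵢ[ℝ] V)) (z₀ : Complexified V) (ε : ℝ) : Prop where
  pos : 0 < ε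
  sign_fst : ∀ z ∈ Metric.ball z₀ ε, ∀ v ∈ normals W, (inner ℝ v z₀.1 : ℝ) ≠ 0 →
    SignType.sign (inner ℝ v z.1 : ℝ) = SignType.sign (inner ℝ v z₀.1 : ℝ)
  sign_snd : ∀ z ∈ Metric.ball z₀ ε, ∀ v ∈ normals W, (inner ℝ v z₀.2 : ℝ) ≠ 0 →
    SignType.sign (inner ℝ v z.2 : ℝ) = SignType.sign (inner ℝ v z₀.2 : ℝ)
  map_eq : ∀ z ∈ Metric.ball z₀ ε, ∀ w ∈ W, Prod.map w w z ∈ Metric.ball z₀ ε →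
    Prod.map w w z₀ = z₀

lemma exists_isSmall (hfin : Finite W) (z₀ : Complexified V) : ∃ ε, IsSmall W z₀ ε := by
  have h1 : ∀ᶠ z : Complexified V in 𝓝 z₀, ∀ v ∈ normals W, (inner ℝ v z₀.1 : ℝ) ≠ 0 →
      SignType.sign (inner ℝ v z.1 : ℝ) = SignType.sign (inner ℝ v z₀.1 : ℝ) :=
    continuous_fst.continuousAt.eventually (eventually_forall_sign_eq hfin z₀.1)
  have h2 : ∀ᶠ z : Complexified V in 𝓝 z₀, ∀ v ∈ normals W, (inner ℝ v z₀.2 : ℝ) ≠ 0 →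
      SignType.sign (inner ℝ v z.2 : ℝ) = SignType.sign (inner ℝ v z₀.2 : ℝ) :=
    continuous_snd.continuousAt.eventually (eventually_forall_sign_eq hfin z₀.2)
  have hWf : (W : Set (V ≃ₗᵢ[ℝ] V)).Finite := Set.toFinite _
  -- For each of the finitely many w that move z₀, the condition w a ≠ b is open around (z₀, z₀).
  have h3 : ∀ᶠ p : Complexified V × Complexified V in 𝓝 (z₀, z₀),
      ∀ w ∈ (W : Set (V ≃ₗᵢ[ℝ] V)), Prod.map w w z₀ ≠ z₀ → Prod.map w w p.1 ≠ p.2 := by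
    rw [hWf.eventually_all]
    intro w _
    rw [eventually_imp_distrib_left]
    intro hne
    have hc : Continuous fun p : Complexified V × Complexified V => Prod.map w w p.1 :=
      (continuous_map_isometry w).comp continuous_fst
    exact (isOpen_ne_fun hc continuous_snd).mem_nhds hne
  rw [nhds_prod_eq] at h3
  obtain ⟨O, hO, h3⟩ := (eventually_prod_self_iff (r := fun a b => ∀ w ∈ (W : Set (V ≃ₗᵢ[ℝ] V)),
    Prod.map w w z₀ ≠ z₀ → Prod.map w w a ≠ b)).1 h3
  obtain ⟨ε, hε, h⟩ := Metric.eventually_nhds_iff_ball.1 ((h1.and h2).and hO)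
  refine ⟨ε, hε, fun z hz => (h z hz).1.1, fun z hz => (h z hz).1.2, fun z hz w hw hwz => ?_⟩
  by_contra hne
  exact h3 z (h z hz).2 _ (h _ hwz).2 w hw hne rfl

/-- The points of the complexification of the smallest flat through `z₀` which are closer than
`ε` to `z₀`. -/
def box (W : Subgroup (V ≃ₗᵢ[ℝ] V)) (z₀ : Complexified V) (ε : ℝ) : Set (Complexified V) :=
  {z | z ∈ Metric.ball z₀ ε ∧ z.1 ∈ flatOf W z₀ ∧ z.2 ∈ flatOf W z₀}

variable {z₀ : Complexified V} {ε : ℝ}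

lemma IsSmall.center_mem_box (hε : IsSmall W z₀ ε) : z₀ ∈ box W z₀ ε :=
  ⟨Metric.mem_ball_self hε.pos, fst_mem_flatOf z₀, snd_mem_flatOf z₀⟩

lemma convex_box : Convex ℝ (box W z₀ ε) := by
  have : box W z₀ ε = Metric.ball z₀ ε ∩
      (((flatOf W z₀).prod (flatOf W z₀) : Submodule ℝ (V × V)) : Set (V × V)) := by
    ext z
    simp [box]
  rw [this]
  exact (convex_ball _ _).inter (Submodule.convex _)

/-- The distance on the complexification is the maximum of the two distances, so a box is a product.
-/
lemma mk_mem_box {z z' : Complexified V} (hz : z ∈ box W z₀ ε) (hz' : z' ∈ box W z₀ ε) :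
    (z.1, z'.2) ∈ box W z₀ ε := by
  refine ⟨?_, hz.2.1, hz'.2.2⟩
  have h1 := hz.1
  have h2 := hz'.1
  rw [Metric.mem_ball, Prod.dist_eq, max_lt_iff] at h1 h2 ⊢
  exact ⟨h1.1, h2.2⟩

lemma IsSmall.mem_flatClass (hε : IsSmall W z₀ ε) {z : Complexified V} (hz : z ∈ box W z₀ ε) :
    z ∈ flatClass W z₀ := by
  intro v hv
  constructor
  · rintro ⟨h1, h2⟩
    constructor
    · by_contra hne
      exact hne ((eq_zero_iff_of_sign_eq (hε.sign_fst z hz.1 v hv hne)).1 h1)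
    · by_contra hne
      exact hne ((eq_zero_iff_of_sign_eq (hε.sign_snd z hz.1 v hv hne)).1 h2)
  · rintro ⟨h1, h2⟩
    exact ⟨mem_flatOf_iff.1 hz.2.1 v hv h1 h2, mem_flatOf_iff.1 hz.2.2 v hv h1 h2⟩

/-- A nearby point lies in no complexified hyperplane that misses z₀; in the same stratum it lies in
as many as z₀ does, hence in the same ones, hence in the flat. -/
lemma IsSmall.mem_box (hfin : Finite W) (hε : IsSmall W z₀ ε) {z : Complexified V}
    (hz : z ∈ Metric.ball z₀ ε) (h : proj W z ∈ proj W '' flatClass W z₀) : z ∈ box W z₀ ε := by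
  have hsub : {v ∈ unitNormals W | (inner ℝ v z.1 : ℝ) = 0 ∧ (inner ℝ v z.2 : ℝ) = 0} ⊆
      {v ∈ unitNormals W | (inner ℝ v z₀.1 : ℝ) = 0 ∧ (inner ℝ v z₀.2 : ℝ) = 0} := by
    rintro v ⟨hv, h1, h2⟩
    refine ⟨hv, ?_, ?_⟩
    · by_contra hne
      exact hne ((eq_zero_iff_of_sign_eq (hε.sign_fst z hz v hv.1 hne)).1 h1)
    · by_contra hne
      exact hne ((eq_zero_iff_of_sign_eq (hε.sign_snd z hz v hv.1 hne)).1 h2)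
  have heq := Set.eq_of_subset_of_ncard_le hsub (ncard_eq_of_proj_mem_flatClass h).ge
    ((finite_unitNormals hfin).subset fun v hv => hv.1)
  have key : ∀ v ∈ normals W, (inner ℝ v z₀.1 : ℝ) = 0 → (inner ℝ v z₀.2 : ℝ) = 0 →
      (inner ℝ v z.1 : ℝ) = 0 ∧ (inner ℝ v z.2 : ℝ) = 0 := by
    intro v hv h1 h2
    obtain ⟨c, hc, v', hv', rfl⟩ := exists_unitNormal hv
    simp only [real_inner_smul_left, mul_eq_zero, or_iff_right hc.ne'] at h1 h2 ⊢
    have : v' ∈ {v ∈ unitNormals W | (inner ℝ v z.1 : ℝ) = 0 ∧ (inner ℝ v z.2 : ℝ) = 0} :=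
      heq ▸ ⟨hv', h1, h2⟩
    exact this.2
  exact ⟨hz, mem_flatOf_iff.2 fun v hv h1 h2 => (key v hv h1 h2).1,
    mem_flatOf_iff.2 fun v hv h1 h2 => (key v hv h1 h2).2⟩

/-- An element of W identifying two points of the box fixes z₀, and therefore fixes the flat of z₀
pointwise. -/
lemma IsSmall.injOn_proj (hW : IsFiniteReflectionGroup W) (hε : IsSmall W z₀ ε) :
    Set.InjOn (proj W) (box W z₀ ε) := by
  intro z hz z' hz' h
  obtain ⟨w, hw, rfl⟩ := proj_eq_iff.1 h
  have h0 := hε.map_eq z hz.1 w hw hz'.1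
  exact Prod.ext (map_eq_of_mem_flatOf hW hw h0 hz.2.1).symm
    (map_eq_of_mem_flatOf hW hw h0 hz.2.2).symm

/-- Horizontal moves along the real part, at the height of `z₀`, stay in one cell. -/
lemma IsSmall.mem_cellClass (hε : IsSmall W z₀ ε) {x : V} (hx : (x, z₀.2) ∈ box W z₀ ε) :
    (x, z₀.2) ∈ cellClass W z₀ := by
  refine ⟨mem_faceOf_self _, fun v hv h0 => ?_⟩
  by_cases h1 : (inner ℝ v z₀.1 : ℝ) = 0
  · rw [h1, mem_flatOf_iff.1 hx.2.1 v hv h1 h0]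
  · exact hε.sign_fst _ hx.1 v hv h1

/-- Vertical moves along the imaginary part stay in the image of one cell under the involution. -/
lemma IsSmall.mem_swapClass (hε : IsSmall W z₀ ε) {x y y' : V} (hy : (x, y) ∈ box W z₀ ε)
    (hy' : (x, y') ∈ box W z₀ ε) : (x, y') ∈ swapClass (cellClass W) (x, y) := by
  refine ⟨mem_faceOf_self _, fun v hv h0 => ?_⟩
  have h0 : (inner ℝ v x : ℝ) = 0 := h0
  have hx0 : (inner ℝ v z₀.1 : ℝ) = 0 := by
    by_contra hne
    exact hne ((eq_zero_iff_of_sign_eq (hε.sign_fst _ hy.1 v hv hne)).1 h0)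
  show SignType.sign (inner ℝ v y' : ℝ) = SignType.sign (inner ℝ v y : ℝ)
  by_cases h1 : (inner ℝ v z₀.2 : ℝ) = 0
  · rw [mem_flatOf_iff.1 hy.2.2 v hv hx0 h1, mem_flatOf_iff.1 hy'.2.2 v hv hx0 h1]
  · rw [hε.sign_snd _ hy.1 v hv h1, hε.sign_snd _ hy'.1 v hv h1]

/-- The projection embeds a small box as an open subset of a stratum. -/
lemma IsSmall.isOpenEmbedding (hW : IsFiniteReflectionGroup W) (hε : IsSmall W z₀ ε) :
    IsOpenEmbedding (fun z : box W z₀ ε => (⟨proj W z.1, z.1, hε.mem_flatClass z.2, rfl⟩ :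
      proj W '' flatClass W z₀)) := by
  refine IsOpenEmbedding.of_continuous_injective_isOpenMap ?_ ?_ ?_
  · exact (continuous_proj.comp continuous_subtype_val).subtype_mk _
  · intro z z' h
    exact Subtype.ext (hε.injOn_proj hW z.2 z'.2 (congrArg Subtype.val h))
  · rintro _ ⟨O, hO, rfl⟩
    -- The image of the ball is open in the whole quotient, and points of the ball that land in the
    -- stratum already lie in the box.
    refine ⟨proj W '' (O ∩ Metric.ball z₀ ε), isOpenMap_proj _ (hO.inter Metric.isOpen_ball), ?_⟩
    ext ⟨q, hq⟩
    constructor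
    · rintro ⟨z, ⟨hzO, hz⟩, rfl⟩
      exact ⟨⟨z, hε.mem_box hW.1 hz hq⟩, hzO, rfl⟩
    · rintro ⟨z, hz, h⟩
      exact ⟨z.1, ⟨hz, z.2.1⟩, congrArg Subtype.val h⟩

end Boxes

/-! ### Sections of germs along maps, and their transport along paths. -/

section Sections

open Filter Topology Opposite

variable {k : Type u} [Field k] {X : TopCat.{u}} (F : TopCat.Presheaf (ModuleCat.{u} k) X)

/-- Near `t₀`, the family `σ` of germs along the map `f` comes from a section of `F`. -/
def IsSectionAt {T : Type*} [TopologicalSpace T] (f : T → X) (σ : ∀ t, F.stalk (f t)) (t₀ : T) :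
    Prop :=
  ∃ (U : Opens X) (s : F.obj (op U)), ∀ᶠ t in 𝓝 t₀, ∃ h : f t ∈ U, σ t = F.germ U (f t) h s

/-- Near `t₀`, the germs of `F` along `f` are trivialized by a family of sections. -/
def IsTrivialAt {T : Type*} [TopologicalSpace T] (f : T → X) (t₀ : T) : Prop :=
  ∃ (M : Type u) (ψ : M → ∀ t, F.stalk (f t)), ∀ᶠ t in 𝓝 t₀,
    Function.Bijective (fun m => ψ m t) ∧ ∀ m, IsSectionAt F f (ψ m) t

/-- Every germ along `f` extends to a unique section along `f`. -/
def HasUniqueSections {T : Type*} [TopologicalSpace T] (f : T → X) : Prop :=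
  ∀ (t : T) (e : F.stalk (f t)), ∃! σ : ∀ t, F.stalk (f t), (∀ t, IsSectionAt F f σ t) ∧ σ t = e

variable {F} {T : Type*} [TopologicalSpace T] {f : T → X} {σ τ : ∀ t, F.stalk (f t)} {t₀ : T}

lemma IsSectionAt.eventually (h : IsSectionAt F f σ t₀) : ∀ᶠ t in 𝓝 t₀, IsSectionAt F f σ t := by
  obtain ⟨U, s, h⟩ := h
  filter_upwards [eventually_eventually_nhds.2 h] with t ht
  exact ⟨U, s, ht⟩

lemma IsSectionAt.congr (h : IsSectionAt F f σ t₀) (heq : ∀ᶠ t in 𝓝 t₀, τ t = σ t) :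
    IsSectionAt F f τ t₀ := by
  obtain ⟨U, s, h⟩ := h
  refine ⟨U, s, ?_⟩
  filter_upwards [h, heq] with t ht ht'
  rwa [ht']

lemma IsSectionAt.eventually_eq (hσ : IsSectionAt F f σ t₀) (hτ : IsSectionAt F f τ t₀)
    (hf : ContinuousAt f t₀) (heq : σ t₀ = τ t₀) : ∀ᶠ t in 𝓝 t₀, σ t = τ t := by
  obtain ⟨U, s, h⟩ := hσ
  obtain ⟨U', s', h'⟩ := hτ
  obtain ⟨hU, e⟩ := h.self_of_nhds
  obtain ⟨hU', e'⟩ := h'.self_of_nhds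
  obtain ⟨O, hO, iU, iU', hres⟩ := F.germ_eq (f t₀) hU hU' s s' (by rw [← e, ← e', heq])
  filter_upwards [h, h', hf.eventually (O.isOpen.mem_nhds hO)] with t ⟨h1, h2⟩ ⟨h3, h4⟩ h5
  rw [h2, h4, ← F.germ_res_apply iU _ h5, ← F.germ_res_apply iU' _ h5, hres]

lemma exists_isSectionAt (hf : ContinuousAt f t₀) (e : F.stalk (f t₀)) :
    ∃ σ : ∀ t, F.stalk (f t), IsSectionAt F f σ t₀ ∧ σ t₀ = e := by
  classical
  obtain ⟨U, hU, s, rfl⟩ := F.exists_germ_eq e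
  refine ⟨fun t => if h : f t ∈ U then F.germ U (f t) h s else 0, ⟨U, s, ?_⟩, dif_pos hU⟩
  filter_upwards [hf.eventually (U.isOpen.mem_nhds hU)] with t ht
  exact ⟨ht, dif_pos ht⟩

lemma IsSectionAt.comp {S : Type*} [TopologicalSpace S] {g : S → T} {s₀ : S}
    (h : IsSectionAt F f σ (g s₀)) (hg : ContinuousAt g s₀) :
    IsSectionAt F (fun s => f (g s)) (fun s => σ (g s)) s₀ := by
  obtain ⟨U, s, h⟩ := h
  exact ⟨U, s, hg.eventually h⟩

lemma IsTrivialAt.comp {S : Type*} [TopologicalSpace S] {g : S → T} {s₀ : S}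
    (h : IsTrivialAt F f (g s₀)) (hg : ContinuousAt g s₀) (hg' : ∀ᶠ s in 𝓝 s₀, ContinuousAt g s) :
    IsTrivialAt F (fun s => f (g s)) s₀ := by
  obtain ⟨M, ψ, h⟩ := h
  refine ⟨M, fun m s => ψ m (g s), ?_⟩
  filter_upwards [hg.eventually h, hg'] with s hs hs'
  exact ⟨hs.1, fun m => (hs.2 m).comp hs'⟩

/-- Agreement of two sections is always an open condition; a trivialization makes disagreement open
as well. -/
lemma eqOn_of_isSectionAt (hf : Continuous f) {J : Set T} (hJ : IsPreconnected J)
    (htriv : ∀ t ∈ J, IsTrivialAt F f t) (hσ : ∀ t ∈ J, IsSectionAt F f σ t)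
    (hτ : ∀ t ∈ J, IsSectionAt F f τ t) {t₁ : T} (ht₁ : t₁ ∈ J) (heq : σ t₁ = τ t₁) :
    ∀ t ∈ J, σ t = τ t := by
  by_contra! hcon
  obtain ⟨t₂, ht₂, hne⟩ := hcon
  have hclosed : ∀ t ∈ J, σ t ≠ τ t → ∀ᶠ t' in 𝓝 t, σ t' ≠ τ t' := by
    intro t ht hne
    obtain ⟨M, ψ, hψ⟩ := htriv t ht
    obtain ⟨hbij, hsec⟩ := hψ.self_of_nhds
    obtain ⟨m, hm⟩ := hbij.2 (σ t)
    obtain ⟨m', hm'⟩ := hbij.2 (τ t)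
    have h1 := (hsec m).eventually_eq (hσ t ht) hf.continuousAt hm
    have h2 := (hsec m').eventually_eq (hτ t ht) hf.continuousAt hm'
    filter_upwards [hψ, h1, h2] with t' h3 h4 h5 h6
    rw [← h4, ← h5] at h6
    exact hne (by rw [← hm, ← hm', h3.1.1 h6])
  obtain ⟨t, ht, h1, h2⟩ := hJ (interior {t | σ t = τ t}) (interior {t | σ t ≠ τ t})
    isOpen_interior isOpen_interior
    (fun t ht => by
      by_cases h : σ t = τ t
      · exact Or.inl (mem_interior_iff_mem_nhds.2
          ((hσ t ht).eventually_eq (hτ t ht) hf.continuousAt h))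
      · exact Or.inr (mem_interior_iff_mem_nhds.2 (hclosed t ht h)))
    ⟨t₁, ht₁, mem_interior_iff_mem_nhds.2
      ((hσ t₁ ht₁).eventually_eq (hτ t₁ ht₁) hf.continuousAt heq)⟩
    ⟨t₂, ht₂, mem_interior_iff_mem_nhds.2 (hclosed t₂ ht₂ hne)⟩
  have h3 : t ∈ {t | σ t = τ t} := interior_subset h1
  have h4 : t ∈ {t | σ t ≠ τ t} := interior_subset h2
  exact h4 h3

lemma exists_ordConnected_nhds (t : unitInterval) {N : Set unitInterval} (hN : N ∈ 𝓝 t) :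
    ∃ J ⊆ N, IsOpen J ∧ t ∈ J ∧ J.OrdConnected := by
  obtain ⟨ε, hε, h⟩ := Metric.mem_nhds_iff.1 hN
  refine ⟨_, h, Metric.isOpen_ball, Metric.mem_ball_self hε, ?_⟩
  have : Metric.ball t ε = (Subtype.val : unitInterval → ℝ) ⁻¹' Metric.ball (t : ℝ) ε := rfl
  rw [this, Real.ball_eq_Ioo]
  exact Set.ordConnected_Ioo.preimage_mono (Subtype.mono_coe _)

lemma forall_of_locally_iff {P : unitInterval → Prop}
    (h : ∀ t, ∃ J ∈ 𝓝 t, ∀ t₁ ∈ J, ∀ t₂ ∈ J, P t₁ → P t₂)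
    {t₀ : unitInterval} (h₀ : P t₀) (t : unitInterval) : P t := by
  have hP : IsLocallyConstant P := by
    rw [IsLocallyConstant.iff_eventually_eq]
    intro t
    obtain ⟨J, hJ, h⟩ := h t
    filter_upwards [hJ] with t' ht'
    have ht := mem_of_mem_nhds hJ
    exact propext ⟨h t' ht' t ht, h t ht t' ht'⟩
  rw [hP.apply_eq_of_preconnectedSpace t t₀]
  exact h₀

/-- Sections extend along paths on which the sheaf is locally trivial. -/
lemma exists_section_path {f : unitInterval → X} (hf : Continuous f)
    (htriv : ∀ t, IsTrivialAt F f t)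
    (e : F.stalk (f 0)) : ∃ σ : ∀ t, F.stalk (f t), (∀ t, IsSectionAt F f σ t) ∧ σ 0 = e := by
  classical
  -- Whether a section exists on [0, t] does not change as t varies in a trivializing interval, so
  -- connectedness carries existence from 0 to 1.
  suffices h : ∀ t : unitInterval,
      ∃ σ : ∀ t, F.stalk (f t), (∀ t' ≤ t, IsSectionAt F f σ t') ∧ σ 0 = e by
    obtain ⟨σ, h1, h2⟩ := h 1
    exact ⟨σ, fun t => h1 t t.2.2, h2⟩
  refine forall_of_locally_iff (t₀ := 0) (fun t => ?_) ?_
  · obtain ⟨M, ψ, hψ⟩ := htriv t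
    obtain ⟨J, hJN, hJ, htJ, hord⟩ := exists_ordConnected_nhds t hψ
    refine ⟨J, hJ.mem_nhds htJ, ?_⟩
    rintro a ha b hb ⟨σ, hσ, hσ0⟩
    rcases le_total b a with hba | hab
    · exact ⟨σ, fun t' h => hσ t' (h.trans hba), hσ0⟩
    obtain ⟨hbij, hsec⟩ := hJN ha
    obtain ⟨m, hm⟩ := hbij.2 (σ a)
    have hnear := (hsec m).eventually_eq (hσ a le_rfl) hf.continuousAt hm
    refine ⟨fun s => if s ≤ a then σ s else ψ m s, fun s hs => ?_, (if_pos a.2.1).trans hσ0⟩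
    rcases lt_trichotomy s a with hsa | rfl | hsa
    · refine (hσ s hsa.le).congr ?_
      filter_upwards [gt_mem_nhds hsa] with s' hs'
      exact if_pos hs'.le
    · refine (hσ s le_rfl).congr ?_
      filter_upwards [hnear] with s' hs'
      split_ifs
      · rfl
      · exact hs'
    · refine ((hJN (hord.out ha hb ⟨hsa.le, hs⟩)).2 m).congr ?_
      filter_upwards [lt_mem_nhds hsa] with s' hs'
      exact if_neg (not_le.2 hs')
  · obtain ⟨σ, h1, h2⟩ := exists_isSectionAt hf.continuousAt e
    exact ⟨σ, fun t' ht' => (le_antisymm ht' t'.2.1 : t' = 0) ▸ h1, h2⟩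

/-- A family of sections along paths which varies continuously at the origins of the paths is
a section. -/
lemma isSectionAt_of_paths {A : Type*} [TopologicalSpace A]
    {f : A × unitInterval → X} (hf : Continuous f)
    (htriv : ∀ a t, IsTrivialAt F (fun t => f (a, t)) t) {σ : ∀ p, F.stalk (f p)}
    (hσ : ∀ a t, IsSectionAt F (fun t => f (a, t)) (fun t => σ (a, t)) t)
    (hbase : ∀ a, IsSectionAt F (fun a => f (a, 0)) (fun a => σ (a, 0)) a) (p : A × unitInterval) :
    IsSectionAt F f σ p := by
  obtain ⟨a, t⟩ := p
  -- Triviality is known only along each path, not jointly. A local section τ is matched with σ on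
  -- the path of a; once they agree at one time t₁ for all a' near a, uniqueness along each path
  -- spreads the agreement over J.
  have key : ∀ t, ∃ J ∈ 𝓝 t, ∃ τ : ∀ p, F.stalk (f p), (∀ t' ∈ J, IsSectionAt F f τ (a, t')) ∧
      (∀ t' ∈ J, σ (a, t') = τ (a, t')) ∧
      ∀ t₁ ∈ J, (∀ᶠ a' in 𝓝 a, σ (a', t₁) = τ (a', t₁)) →
        ∀ t₂ ∈ J, IsSectionAt F f σ (a, t₂) := by
    intro t
    obtain ⟨τ, hτ, hτσ⟩ := exists_isSectionAt (t₀ := (a, t)) hf.continuousAt (σ (a, t))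
    have h1 := hτ.eventually
    rw [nhds_prod_eq, eventually_prod_iff] at h1
    obtain ⟨pa, hpa, pt, hpt, h1⟩ := h1
    have hslice : ∀ (a' : A) (t' : unitInterval), IsSectionAt F f τ (a', t') →
        IsSectionAt F (fun t => f (a', t)) (fun t => τ (a', t)) t' :=
      fun a' t' h => h.comp (g := fun t => (a', t)) (by fun_prop)
    have h2 := (hσ a t).eventually_eq (hslice a t hτ) (by fun_prop) hτσ.symm
    obtain ⟨J, hJN, hJ, htJ, hord⟩ := exists_ordConnected_nhds t (hpt.and h2)
    refine ⟨J, hJ.mem_nhds htJ, τ, fun t' ht' => h1 hpa.self_of_nhds (hJN ht').1,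
      fun t' ht' => (hJN ht').2, fun t₁ ht₁ hev t₂ ht₂ => ?_⟩
    refine (h1 hpa.self_of_nhds (hJN ht₂).1).congr ?_
    rw [nhds_prod_eq]
    refine ((hev.and hpa).prod_mk (hJ.mem_nhds ht₂)).mono ?_
    rintro ⟨a', t'⟩ ⟨⟨h3, h4⟩, h5⟩
    exact eqOn_of_isSectionAt (f := fun t => f (a', t)) (by fun_prop) hord.isPreconnected
      (fun t _ => htriv a' t) (fun t _ => hσ a' t)
      (fun t ht => hslice a' t (h1 h4 (hJN ht).1)) ht₁ h3 t' h5
  refine forall_of_locally_iff (P := fun t => IsSectionAt F f σ (a, t)) (t₀ := 0)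
    (fun t => ?_) ?_ t
  · obtain ⟨J, hJ, τ, h1, h2, h3⟩ := key t
    refine ⟨J, hJ, fun t₁ ht₁ t₂ ht₂ hsec => h3 t₁ ht₁ ?_ t₂ ht₂⟩
    have h4 := hsec.eventually_eq (h1 t₁ ht₁) hf.continuousAt (h2 t₁ ht₁)
    exact (Continuous.prodMk_left t₁).continuousAt.eventually h4
  · obtain ⟨J, hJ, τ, h1, h2, h3⟩ := key 0
    have h0 := mem_of_mem_nhds hJ
    refine h3 0 h0 ?_ 0 h0
    exact (hbase a).eventually_eq ((h1 0 h0).comp (g := fun a => (a, 0)) (by fun_prop))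
      (by fun_prop) (h2 0 h0)

lemma exists_section_paths {A : Type*} [TopologicalSpace A]
    {f : A × unitInterval → X} (hf : Continuous f)
    (htriv : ∀ a t, IsTrivialAt F (fun t => f (a, t)) t) {σ₀ : ∀ a, F.stalk (f (a, 0))}
    (hσ₀ : ∀ a, IsSectionAt F (fun a => f (a, 0)) σ₀ a) :
    ∃ σ : ∀ p, F.stalk (f p), (∀ p, IsSectionAt F f σ p) ∧ ∀ a, σ (a, 0) = σ₀ a := by
  choose σ hσ hσ' using fun a => exists_section_path (f := fun t => f (a, t)) (by fun_prop)
    (htriv a) (σ₀ a)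
  refine ⟨fun p => σ p.1 p.2, isSectionAt_of_paths hf htriv hσ ?_, hσ'⟩
  intro a
  exact (hσ₀ a).congr (Eventually.of_forall hσ')

lemma exists_section_of_homeomorph {S : Type*} [TopologicalSpace S] (ρ : S ≃ₜ T) (f : T → X)
    {σ' : ∀ s, F.stalk (f (ρ s))} (hσ' : ∀ s, IsSectionAt F (fun s => f (ρ s)) σ' s) :
    ∃ σ : ∀ t, F.stalk (f t), (∀ t, IsSectionAt F f σ t) ∧ ∀ s, σ (ρ s) = σ' s := by
  have hval := Equiv.piCongrLeft_apply_apply (fun t => (F.stalk (f t) : Type u)) ρ.toEquiv σ'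
  refine ⟨Equiv.piCongrLeft (fun t => (F.stalk (f t) : Type u)) ρ.toEquiv σ', fun t => ?_, hval⟩
  obtain ⟨s, rfl⟩ := ρ.surjective t
  obtain ⟨U, u, h⟩ := hσ' s
  refine ⟨U, u, ?_⟩
  rw [← ρ.map_nhds_eq, eventually_map]
  filter_upwards [h] with s' hs'
  obtain ⟨h1, h2⟩ := hs'
  exact ⟨h1, (hval s').trans h2⟩

lemma HasUniqueSections.of_homeomorph {S : Type*} [TopologicalSpace S] (ρ : S ≃ₜ T) {f : T → X}
    (h : HasUniqueSections F fun s => f (ρ s)) : HasUniqueSections F f := by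
  intro t e
  obtain ⟨s, rfl⟩ := ρ.surjective t
  obtain ⟨σ', ⟨h1, h2⟩, h3⟩ := h s e
  obtain ⟨σ, h4, h5⟩ := exists_section_of_homeomorph ρ f h1
  refine ⟨σ, ⟨h4, (h5 s).trans h2⟩, ?_⟩
  rintro τ ⟨h6, h7⟩
  have h8 := h3 (fun s => τ (ρ s)) ⟨fun s => (h6 (ρ s)).comp ρ.continuous.continuousAt, h7⟩
  funext t
  obtain ⟨s, rfl⟩ := ρ.surjective t
  rw [h5, ← h8]

lemma exists_section_paths_one {A : Type*} [TopologicalSpace A] {f : A × unitInterval → X}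
    (hf : Continuous f) (htriv : ∀ a t, IsTrivialAt F (fun t => f (a, t)) t) {t₁ : unitInterval}
    (ht₁ : t₁ = 1) {σ₁ : ∀ a, F.stalk (f (a, t₁))}
    (hσ₁ : ∀ a, IsSectionAt F (fun a => f (a, t₁)) σ₁ a) :
    ∃ σ : ∀ p, F.stalk (f p), (∀ p, IsSectionAt F f σ p) ∧ ∀ a, σ (a, t₁) = σ₁ a := by
  -- Keeping the end time as a variable equal to 1 lets it be replaced by the reversal of 0, so no
  -- transport between stalks is needed.
  obtain rfl : t₁ = unitInterval.symm 0 := by rw [ht₁, unitInterval.symm_zero]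
  let ρ := (Homeomorph.refl A).prodCongr unitInterval.symmHomeomorph
  obtain ⟨σ', h1, h2⟩ := exists_section_paths (f := fun p => f (ρ p)) (by fun_prop)
    (fun a t => (htriv a (unitInterval.symm t)).comp (g := unitInterval.symm) (by fun_prop)
      (Eventually.of_forall fun _ => by fun_prop)) hσ₁
  obtain ⟨σ, h3, h4⟩ := exists_section_of_homeomorph ρ f h1
  exact ⟨σ, h3, fun a => (h4 (a, 0)).trans (h2 a)⟩

/-- Carry a germ at time 1 back along its path, extend it over A at time 0, and carry the extension
forward. Two extensions at time 1 go back to sections at time 0 that share a germ, hence coincide.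
-/
lemma hasUniqueSections_of_paths {A : Type*} [TopologicalSpace A] {f : A × unitInterval → X}
    (hf : Continuous f) (htriv : ∀ a t, IsTrivialAt F (fun t => f (a, t)) t)
    (h : HasUniqueSections F fun a => f (a, 0)) : HasUniqueSections F fun a => f (a, 1) := by
  have hlevel : ∀ {s : ∀ p, F.stalk (f p)}, (∀ p, IsSectionAt F f s p) → ∀ t a,
      IsSectionAt F (fun a => f (a, t)) (fun a => s (a, t)) a :=
    fun hs t a => (hs (a, t)).comp (g := fun a => (a, t)) (by fun_prop)
  have huniq : ∀ {s s' : ∀ p, F.stalk (f p)}, (∀ p, IsSectionAt F f s p) →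
      (∀ p, IsSectionAt F f s' p) → ∀ {a t}, s (a, t) = s' (a, t) →
      ∀ t', s (a, t') = s' (a, t') := by
    intro s s' hs hs' a t he t'
    exact eqOn_of_isSectionAt (f := fun t => f (a, t)) (σ := fun t => s (a, t))
      (τ := fun t => s' (a, t)) (by fun_prop) isPreconnected_univ (fun t _ => htriv a t)
      (fun t _ => (hs (a, t)).comp (g := fun t => (a, t)) (by fun_prop))
      (fun t _ => (hs' (a, t)).comp (g := fun t => (a, t)) (by fun_prop))
      (Set.mem_univ t) he t' (Set.mem_univ t')
  intro a e
  obtain ⟨ρ, hρ, hρ1⟩ := exists_section_paths_one (A := Unit) (f := fun p => f (a, p.2))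
    (by fun_prop) (fun _ t => htriv a t) rfl (σ₁ := fun _ => e)
    (fun _ => by
      obtain ⟨U, hU, s, rfl⟩ := F.exists_germ_eq e
      exact ⟨U, s, Eventually.of_forall fun _ => ⟨hU, rfl⟩⟩)
  obtain ⟨σ₀, ⟨hσ₀, hσ₀a⟩, -⟩ := h a (ρ ((), 0))
  obtain ⟨σ, hσ, hσ0⟩ := exists_section_paths hf htriv hσ₀
  have heq : ∀ t, σ (a, t) = ρ ((), t) := fun t =>
    eqOn_of_isSectionAt (f := fun t => f (a, t)) (σ := fun t => σ (a, t))
      (τ := fun t => ρ ((), t)) (by fun_prop)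
      isPreconnected_univ (fun t _ => htriv a t)
      (fun t _ => (hσ (a, t)).comp (g := fun t => (a, t)) (by fun_prop))
      (fun t _ => (hρ ((), t)).comp (g := fun t => ((), t)) (by fun_prop))
      (Set.mem_univ 0) ((hσ0 a).trans hσ₀a) t (Set.mem_univ t)
  refine ⟨fun a => σ (a, 1), ⟨hlevel hσ 1, (heq 1).trans (hρ1 ())⟩, ?_⟩
  rintro τ₁ ⟨hτ₁, hτ₁a⟩
  obtain ⟨τ, hτ, hτ1⟩ := exists_section_paths_one hf htriv rfl hτ₁
  have h0 : σ (a, 0) = τ (a, 0) :=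
    huniq hσ hτ (t := 1) (by rw [hτ1, hτ₁a]; exact (heq 1).trans (hρ1 ())) 0
  have hall : (fun a => τ (a, 0)) = fun a => σ (a, 0) :=
    (h a (σ (a, 0))).unique ⟨hlevel hτ 0, h0.symm⟩ ⟨hlevel hσ 0, rfl⟩
  funext a'
  rw [← hτ1]
  exact huniq hτ hσ (t := 0) (congrFun hall a') 1

lemma hasUniqueSections_const {A : Type*} [TopologicalSpace A] [PreconnectedSpace A] (x : X) :
    HasUniqueSections F fun _ : A => x := by
  have hconst : ∀ (e : F.stalk x) (a : A), IsSectionAt F (fun _ : A => x) (fun _ => e) a := by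
    intro e a
    obtain ⟨U, hU, s, rfl⟩ := F.exists_germ_eq e
    exact ⟨U, s, Eventually.of_forall fun _ => ⟨hU, rfl⟩⟩
  intro a e
  refine ⟨fun _ => e, ⟨hconst e, rfl⟩, ?_⟩
  rintro τ ⟨h1, h2⟩
  funext a'
  exact eqOn_of_isSectionAt (f := fun _ : A => x) continuous_const isPreconnected_univ
    (fun t _ => ⟨F.stalk x, fun e _ => e, Eventually.of_forall fun t =>
      ⟨Function.bijective_id, fun e => hconst e t⟩⟩) (fun t _ => h1 t)
    (fun t _ => hconst e t) (Set.mem_univ a) h2 a' (Set.mem_univ a')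

end Sections

/-! ### Stalks and sections of inverse images. -/

section PullbackStalks

open Filter Topology Opposite TopologicalSpace

variable {k : Type u} [Field k] {T X : TopCat.{u}}

/-- The sheaf associated with a presheaf on a topological space. -/
noncomputable def associatedSheaf (P : TopCat.Presheaf (ModuleCat.{u} k) T) :
    TopCat.Sheaf (ModuleCat.{u} k) T :=
  (presheafToSheaf (Opens.grothendieckTopology T) (ModuleCat.{u} k)).obj P

/-- The canonical map from a presheaf to the associated sheaf. -/
noncomputable def toAssociatedSheaf (P : TopCat.Presheaf (ModuleCat.{u} k) T) :
    P ⟶ (associatedSheaf P).presheaf :=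
  toSheafify (Opens.grothendieckTopology T) P

instance isIso_stalkFunctor_toAssociatedSheaf (P : TopCat.Presheaf (ModuleCat.{u} k) T) (t : T) :
    IsIso ((TopCat.Presheaf.stalkFunctor (ModuleCat.{u} k) t).map (toAssociatedSheaf P)) :=
  TopCat.Presheaf.stalkFunctor_map_unit_toSheafify_isIso t _ P

/-- The morphism of presheaves underlying a morphism of sheaves. -/
def presheafHom {G H : TopCat.Sheaf (ModuleCat.{u} k) T} (φ : G ⟶ H) : G.presheaf ⟶ H.presheaf :=
  (TopCat.Sheaf.forget _ T).map φ

instance isIso_presheafHom {G H : TopCat.Sheaf (ModuleCat.{u} k) T} (φ : G ⟶ H) [IsIso φ] :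
    IsIso (presheafHom φ) :=
  inferInstanceAs (IsIso ((TopCat.Sheaf.forget _ T).map φ))

lemma isIso_of_stalks {G H : TopCat.Sheaf (ModuleCat.{u} k) T} (φ : G ⟶ H)
    (h : ∀ t, IsIso ((TopCat.Presheaf.stalkFunctor (ModuleCat.{u} k) t).map (presheafHom φ))) :
    IsIso φ :=
  (TopCat.Presheaf.isIso_iff_stalkFunctor_map_iso φ).2 h

lemma isIso_stalkFunctor_comp {P Q R : TopCat.Presheaf (ModuleCat.{u} k) T} (a : P ⟶ Q)
    (b : Q ⟶ R) (t : T) (ha : IsIso ((TopCat.Presheaf.stalkFunctor (ModuleCat.{u} k) t).map a)) :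
    IsIso ((TopCat.Presheaf.stalkFunctor (ModuleCat.{u} k) t).map (a ≫ b)) ↔
      IsIso ((TopCat.Presheaf.stalkFunctor (ModuleCat.{u} k) t).map b) := by
  rw [Functor.map_comp]
  exact isIso_comp_left_iff _ _

lemma exists_lift_associatedSheaf {P : TopCat.Presheaf (ModuleCat.{u} k) T}
    {H : TopCat.Sheaf (ModuleCat.{u} k) T} (c : P ⟶ H.presheaf) :
    ∃ φ : associatedSheaf P ⟶ H, toAssociatedSheaf P ≫ presheafHom φ = c :=
  ⟨⟨sheafifyLift _ c H.property⟩, toSheafify_sheafifyLift _ c H.property⟩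

/-- The inverse image of a sheaf is the sheaf associated with the inverse image presheaf. -/
noncomputable def pullbackIsoAssociatedSheaf (f : T ⟶ X) (F : TopCat.Sheaf (ModuleCat.{u} k) X) :
    (TopCat.Sheaf.pullback (ModuleCat.{u} k) f).obj F ≅
      associatedSheaf ((TopCat.Presheaf.pullback (ModuleCat.{u} k) f).obj F.presheaf) :=
  (TopCat.Sheaf.pullbackIso (ModuleCat.{u} k) f).app F

/-- The canonical map from the inverse image presheaf to the inverse image sheaf. -/
noncomputable def presheafPullbackToPullback (f : T ⟶ X)
    (F : TopCat.Sheaf (ModuleCat.{u} k) X) :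
    (TopCat.Presheaf.pullback (ModuleCat.{u} k) f).obj F.presheaf ⟶
      ((TopCat.Sheaf.pullback (ModuleCat.{u} k) f).obj F).presheaf :=
  toAssociatedSheaf _ ≫ presheafHom (pullbackIsoAssociatedSheaf f F).inv

instance isIso_stalkFunctor_presheafPullbackToPullback (f : T ⟶ X)
    (F : TopCat.Sheaf (ModuleCat.{u} k) X) (t : T) :
    IsIso ((TopCat.Presheaf.stalkFunctor (ModuleCat.{u} k) t).map
      (presheafPullbackToPullback f F)) :=
  (isIso_stalkFunctor_comp _ _ t inferInstance).2 inferInstance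

/-- The map induced on stalks by a morphism of presheaves. -/
noncomputable def stalkHom {P Q : TopCat.Presheaf (ModuleCat.{u} k) T} (c : P ⟶ Q) (t : T) :
    P.stalk t ⟶ Q.stalk t :=
  (TopCat.Presheaf.stalkFunctor (ModuleCat.{u} k) t).map c

lemma germ_stalkHom {P Q : TopCat.Presheaf (ModuleCat.{u} k) T} (c : P ⟶ Q) (U : Opens T) (t : T)
    (h : t ∈ U) : P.germ U t h ≫ stalkHom c t = c.app (op U) ≫ Q.germ U t h :=
  TopCat.Presheaf.stalkFunctor_map_germ U t h c

instance isIso_stalkHom_presheafPullbackToPullback (f : T ⟶ X)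
    (F : TopCat.Sheaf (ModuleCat.{u} k) X) (t : T) :
    IsIso (stalkHom (presheafPullbackToPullback f F) t) :=
  isIso_stalkFunctor_presheafPullbackToPullback f F t

/-- The stalk of the inverse image sheaf. -/
noncomputable def pullbackStalkIso (f : T ⟶ X) (F : TopCat.Sheaf (ModuleCat.{u} k) X) (t : T) :
    F.presheaf.stalk (f t) ≅ ((TopCat.Sheaf.pullback (ModuleCat.{u} k) f).obj F).presheaf.stalk t :=
  TopCat.Presheaf.stalkPullbackIso (ModuleCat.{u} k) f F.presheaf t ≪≫
    asIso (stalkHom (presheafPullbackToPullback f F) t)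

/-- The inverse image of a section. -/
noncomputable def pullbackSection (f : T ⟶ X) (F : TopCat.Sheaf (ModuleCat.{u} k) X)
    (U : Opens X) : F.presheaf.obj (op U) ⟶
      ((TopCat.Sheaf.pullback (ModuleCat.{u} k) f).obj F).presheaf.obj (op ((Opens.map f).obj U)) :=
  ((TopCat.Presheaf.pullbackPushforwardAdjunction (ModuleCat.{u} k) f).unit.app F.presheaf).app
      (op U) ≫
    (presheafPullbackToPullback f F).app (op ((Opens.map f).obj U))

lemma germ_pullbackStalkIso (f : T ⟶ X) (F : TopCat.Sheaf (ModuleCat.{u} k) X) (U : Opens X)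
    (t : T) (h : f t ∈ U) : F.presheaf.germ U (f t) h ≫ (pullbackStalkIso f F t).hom =
      pullbackSection f F U ≫
        ((TopCat.Sheaf.pullback (ModuleCat.{u} k) f).obj F).presheaf.germ
          ((Opens.map f).obj U) t h := by
  rw [pullbackStalkIso, pullbackSection, Iso.trans_hom, asIso_hom, Category.assoc]
  exact (TopCat.Presheaf.germ_stalkPullbackHom_assoc _ f F.presheaf t U h _).trans
    (congrArg (CategoryStruct.comp _)
      (germ_stalkHom (presheafPullbackToPullback f F) ((Opens.map f).obj U) t h))

lemma pullbackStalkIso_germ_apply (f : T ⟶ X) (F : TopCat.Sheaf (ModuleCat.{u} k) X)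
    (U : Opens X) (t : T) (h : f t ∈ U) (s : F.presheaf.obj (op U)) :
    (pullbackStalkIso f F t).hom (F.presheaf.germ U (f t) h s) =
      ((TopCat.Sheaf.pullback (ModuleCat.{u} k) f).obj F).presheaf.germ ((Opens.map f).obj U) t h
        (pullbackSection f F U s) := by
  rw [← ConcreteCategory.comp_apply, germ_pullbackStalkIso, ConcreteCategory.comp_apply]

variable {S : Type*} [TopologicalSpace S]

/-- This replaces sections of iterated restrictions by families of germs of F itself. A section of
the inverse image has, at one point, the germ of some pulled-back section, and then agrees with it
nearby. -/
lemma isSectionAt_pullback_iff (f : T ⟶ X) (F : TopCat.Sheaf (ModuleCat.{u} k) X) {g : S → T}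
    {s₀ : S} (hg : ContinuousAt g s₀) (σ : ∀ s, F.presheaf.stalk (f (g s))) :
    IsSectionAt ((TopCat.Sheaf.pullback (ModuleCat.{u} k) f).obj F).presheaf g
      (fun s => (pullbackStalkIso f F (g s)).hom (σ s)) s₀ ↔
    IsSectionAt F.presheaf (fun s => f (g s)) σ s₀ := by
  have hinj : ∀ t, Function.Injective (pullbackStalkIso f F t).hom := fun t =>
    (pullbackStalkIso f F t).toLinearEquiv.injective
  constructor
  · rintro ⟨O, x, h⟩
    obtain ⟨h0, e0⟩ := h.self_of_nhds
    obtain ⟨U, hU, y, hy⟩ := F.presheaf.exists_germ_eq (σ s₀)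
    have e0 : (pullbackStalkIso f F (g s₀)).hom (σ s₀) = _ := e0
    rw [← hy, pullbackStalkIso_germ_apply] at e0
    obtain ⟨N, hN, iU, iO, hres⟩ := TopCat.Presheaf.germ_eq _ _ _ _ _ _ e0
    refine ⟨U, y, ?_⟩
    filter_upwards [h, hg.eventually (N.isOpen.mem_nhds hN)] with s ⟨h1, h2⟩ h3
    have h3 : g s ∈ N := h3
    have h4 : f (g s) ∈ U := iU.le h3
    refine ⟨h4, hinj _ ?_⟩
    rw [h2, pullbackStalkIso_germ_apply, ← TopCat.Presheaf.germ_res_apply _ iU _ h3,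
      ← TopCat.Presheaf.germ_res_apply _ iO _ h3, hres]
  · rintro ⟨U, y, h⟩
    refine ⟨(Opens.map f).obj U, pullbackSection f F U y, ?_⟩
    filter_upwards [h] with s ⟨h1, h2⟩
    exact ⟨h1, by rw [h2, pullbackStalkIso_germ_apply]⟩

end PullbackStalks

/-! ### Constant sheaves recognized by germs of global sections. -/

section ConstantSheaves

open Filter Topology Opposite TopologicalSpace

variable {k : Type u} [Field k] {T : TopCat.{u}}

lemma exists_global_section (H : TopCat.Sheaf (ModuleCat.{u} k) T) (σ : ∀ t : T, H.presheaf.stalk t)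
    (hσ : ∀ t, IsSectionAt H.presheaf (fun t : T => t) σ t) :
    ∃ s : H.presheaf.obj (op ⊤), ∀ t, H.presheaf.germ ⊤ t (Opens.mem_top t) s = σ t := by
  have h : ∀ t : T, ∃ (O : Opens T) (s : H.presheaf.obj (op O)), t ∈ O ∧
      ∀ t' (h : t' ∈ O), σ t' = H.presheaf.germ O t' h s := by
    intro t
    obtain ⟨U, s, h⟩ := hσ t
    obtain ⟨O, hO, hOo, htO⟩ := eventually_nhds_iff.1 h
    have hle : (⟨O, hOo⟩ : Opens T) ≤ U := fun t' ht' => (hO t' ht').1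
    refine ⟨⟨O, hOo⟩, H.presheaf.map (homOfLE hle).op s, htO, fun t' ht' => ?_⟩
    rw [TopCat.Presheaf.germ_res_apply]
    exact (hO t' ht').2
  choose O s hmem hs using h
  obtain ⟨x, hx, -⟩ := H.existsUnique_gluing' O ⊤ (fun t => homOfLE le_top)
    (fun t _ => TopologicalSpace.Opens.mem_iSup.2 ⟨t, hmem t⟩) s (by
      intro t t'
      refine TopCat.Presheaf.section_ext H _ _ _ fun y hy => ?_
      change (H.presheaf.germ _ y hy) _ = (H.presheaf.germ _ y hy) _
      rw [TopCat.Presheaf.germ_res_apply, TopCat.Presheaf.germ_res_apply, ← hs, ← hs])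
  refine ⟨x, fun t => ?_⟩
  rw [hs t t (hmem t), ← hx t, TopCat.Presheaf.germ_res_apply]

/-- The constant presheaf. -/
def constantPresheaf (T : TopCat.{u}) (M : ModuleCat.{u} k) :
    TopCat.Presheaf (ModuleCat.{u} k) T :=
  (Functor.const (Opens T)ᵒᵖ).obj M

lemma bijective_germ_constantPresheaf (M : ModuleCat.{u} k) (t : T) :
    Function.Bijective ((constantPresheaf T M).germ ⊤ t (Opens.mem_top t)) := by
  constructor
  · intro m m' h
    obtain ⟨N, hN, iU, iU', hres⟩ := TopCat.Presheaf.germ_eq _ _ _ _ _ _ h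
    exact hres
  · intro e
    obtain ⟨U, hU, m, rfl⟩ := TopCat.Presheaf.exists_germ_eq _ e
    exact ⟨m, ((constantPresheaf T M).germ_res_apply (homOfLE le_top) t hU m).symm⟩

lemma isIso_stalkFunctor_map_iff {M : ModuleCat.{u} k} {G : TopCat.Presheaf (ModuleCat.{u} k) T}
    (c : constantPresheaf T M ⟶ G) (t : T) :
    IsIso ((TopCat.Presheaf.stalkFunctor (ModuleCat.{u} k) t).map c) ↔
      Function.Bijective fun m : M => G.germ ⊤ t (Opens.mem_top t) (c.app (op ⊤) m) := by
  have h : (fun m : M => G.germ ⊤ t (Opens.mem_top t) (c.app (op ⊤) m)) =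
      (TopCat.Presheaf.stalkFunctor (ModuleCat.{u} k) t).map c ∘
        (constantPresheaf T M).germ ⊤ t (Opens.mem_top t) := by
    funext m
    exact (TopCat.Presheaf.stalkFunctor_map_germ_apply ⊤ t (Opens.mem_top t) c m).symm
  rw [h]
  exact (ConcreteCategory.isIso_iff_bijective _).trans
    (Function.Bijective.of_comp_iff _ (bijective_germ_constantPresheaf M t)).symm

/-- A sheaf whose global sections map bijectively to all stalks is constant. -/
lemma nonempty_iso_constantSheaf (H : TopCat.Sheaf (ModuleCat.{u} k) T)
    (h : ∀ t, Function.Bijective (H.presheaf.germ ⊤ t (Opens.mem_top t))) :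
    Nonempty (H ≅ (constantSheaf (Opens.grothendieckTopology T) (ModuleCat.{u} k)).obj
      (H.presheaf.obj (op ⊤))) := by
  let c : constantPresheaf T (H.presheaf.obj (op ⊤)) ⟶ H.presheaf :=
    { app := fun U => H.presheaf.map (homOfLE le_top).op
      naturality := fun U V i => by
        refine (Category.id_comp _).trans ?_
        exact H.presheaf.map_comp (homOfLE le_top).op i }
  obtain ⟨φ, hφ⟩ := exists_lift_associatedSheaf c
  have hiso : ∀ t, IsIso ((TopCat.Presheaf.stalkFunctor (ModuleCat.{u} k) t).map
      (presheafHom φ)) := by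
    intro t
    have h2 : IsIso ((TopCat.Presheaf.stalkFunctor (ModuleCat.{u} k) t).map c) := by
      rw [isIso_stalkFunctor_map_iff]
      have : (fun m : H.presheaf.obj (op ⊤) => H.presheaf.germ ⊤ t (Opens.mem_top t)
          (c.app (op ⊤) m)) = H.presheaf.germ ⊤ t (Opens.mem_top t) := by
        funext m
        exact H.presheaf.germ_res_apply (homOfLE le_top) t (Opens.mem_top t) m
      rw [this]
      exact h t
    rw [← hφ] at h2
    exact (isIso_stalkFunctor_comp _ _ t inferInstance).1 h2
  have : IsIso φ := isIso_of_stalks φ hiso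
  exact ⟨(asIso φ).symm⟩

/-- The sections of a constant sheaf given by the elements of its module of values. -/
lemma exists_bijective_germ {H : TopCat.Sheaf (ModuleCat.{u} k) T} {M : ModuleCat.{u} k}
    (e : H ≅ (constantSheaf (Opens.grothendieckTopology T) (ModuleCat.{u} k)).obj M) :
    ∃ c : M ⟶ H.presheaf.obj (op ⊤), ∀ t, Function.Bijective fun m =>
      H.presheaf.germ ⊤ t (Opens.mem_top t) (c m) := by
  let e' : associatedSheaf (constantPresheaf T M) ≅ H := e.symm
  let c : constantPresheaf T M ⟶ H.presheaf :=
    toAssociatedSheaf _ ≫ presheafHom e'.hom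
  exact ⟨c.app (op ⊤), fun t => (isIso_stalkFunctor_map_iff c t).1
    ((isIso_stalkFunctor_comp _ _ t inferInstance).2 inferInstance)⟩

end ConstantSheaves

/-! ### From locally constant sheaves to trivial germs, and back. -/

section LocallyConstant

open Filter Topology Opposite

variable {k : Type u} [Field k] {T X : TopCat.{u}}

lemma IsTrivialAt.of_pullback {S : Type*} [TopologicalSpace S] {f : T ⟶ X}
    {F : TopCat.Sheaf (ModuleCat.{u} k) X} {g : S → T} {s₀ : S} (hg : Continuous g)
    (h : IsTrivialAt ((TopCat.Sheaf.pullback (ModuleCat.{u} k) f).obj F).presheaf g s₀) :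
    IsTrivialAt F.presheaf (fun s => f (g s)) s₀ := by
  obtain ⟨M, ψ, h⟩ := h
  let φ := fun s => (pullbackStalkIso f F (g s)).toLinearEquiv
  refine ⟨M, fun m s => (φ s).symm (ψ m s), ?_⟩
  filter_upwards [h] with s hs
  refine ⟨(φ s).symm.bijective.comp hs.1, fun m => ?_⟩
  refine (isSectionAt_pullback_iff f F hg.continuousAt _).1 ((hs.2 m).congr ?_)
  exact Eventually.of_forall fun s => (φ s).apply_symm_apply _

lemma IsTrivialAt.of_isOpen {S : Type*} [TopologicalSpace S]
    {F : TopCat.Presheaf (ModuleCat.{u} k) X} {f : S → X} {O : Set S} (hO : IsOpen O) {u₀ : O}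
    (h : IsTrivialAt F (fun u : O => f u) u₀) : IsTrivialAt F f u₀ := by
  classical
  obtain ⟨M, ψ, h⟩ := h
  -- The value 0 outside O is arbitrary: only a neighbourhood of a point of the open set O matters.
  have hψ : ∀ (m : M) (u : O), (if hs : (u : S) ∈ O then ψ m ⟨u, hs⟩ else 0) = ψ m u :=
    fun m u => dif_pos u.2
  refine ⟨M, fun m s => if hs : s ∈ O then ψ m ⟨s, hs⟩ else 0, ?_⟩
  rw [← hO.isOpenEmbedding_subtypeVal.map_nhds_eq, eventually_map]
  filter_upwards [h] with u ⟨h1, h2⟩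
  refine ⟨?_, fun m => ?_⟩
  · simp only [hψ]
    exact h1
  · obtain ⟨U, s, h3⟩ := h2 m
    refine ⟨U, s, ?_⟩
    rw [← hO.isOpenEmbedding_subtypeVal.map_nhds_eq, eventually_map]
    filter_upwards [h3] with u' ⟨h4, h5⟩
    exact ⟨h4, (hψ m u').trans h5⟩

lemma isTrivialAt_of_iso_constantSheaf {H : TopCat.Sheaf (ModuleCat.{u} k) T}
    {M : ModuleCat.{u} k}
    (e : H ≅ (constantSheaf (Opens.grothendieckTopology T) (ModuleCat.{u} k)).obj M) (t : T) :
    IsTrivialAt H.presheaf (fun t : T => t) t := by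
  obtain ⟨c, hc⟩ := exists_bijective_germ e
  exact ⟨M, fun m t => H.presheaf.germ ⊤ t (Opens.mem_top t) (c m), Eventually.of_forall fun t =>
    ⟨hc t, fun m => ⟨⊤, c m, Eventually.of_forall fun t => ⟨Opens.mem_top t, rfl⟩⟩⟩⟩

lemma finite_stalk_of_iso_constantSheaf {H : TopCat.Sheaf (ModuleCat.{u} k) T}
    {M : ModuleCat.{u} k} [Module.Finite k M]
    (e : H ≅ (constantSheaf (Opens.grothendieckTopology T) (ModuleCat.{u} k)).obj M) (t : T) :
    Module.Finite k (H.presheaf.stalk t) := by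
  obtain ⟨c, hc⟩ := exists_bijective_germ e
  exact Module.Finite.equiv (LinearEquiv.ofBijective
    ((c ≫ H.presheaf.germ ⊤ t (Opens.mem_top t)).hom) (hc t))

lemma IsLocallyConstantOfFiniteRank.isTrivialAt {F : TopCat.Sheaf (ModuleCat.{u} k) X} {B : Set X}
    (h : IsLocallyConstantOfFiniteRank (restrict F B)) (b : B) :
    IsTrivialAt F.presheaf (fun b : B => (b : X)) b := by
  obtain ⟨U, hU, hb, M, -, ⟨e⟩⟩ := h b
  have h1 := isTrivialAt_of_iso_constantSheaf e ⟨b, hb⟩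
  have h2 := (h1.of_pullback continuous_id).of_pullback continuous_subtype_val
  exact IsTrivialAt.of_isOpen hU (u₀ := ⟨b, hb⟩) h2

lemma IsLocallyConstantOfFiniteRank.finite_stalk {F : TopCat.Sheaf (ModuleCat.{u} k) X} {B : Set X}
    (h : IsLocallyConstantOfFiniteRank (restrict F B)) (b : B) :
    Module.Finite k (F.presheaf.stalk (b : X)) := by
  obtain ⟨U, hU, hb, M, hM, ⟨e⟩⟩ := h b
  let jB : TopCat.of B ⟶ X := TopCat.ofHom ⟨Subtype.val, continuous_subtype_val⟩
  let jU : TopCat.of U ⟶ TopCat.of B := TopCat.ofHom ⟨Subtype.val, continuous_subtype_val⟩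
  let u : TopCat.of U := ⟨b, hb⟩
  have h1 : Module.Finite k (((TopCat.Sheaf.pullback (ModuleCat.{u} k) jU).obj
      (restrict F B)).presheaf.stalk u) :=
    finite_stalk_of_iso_constantSheaf e u
  exact Module.Finite.equiv ((pullbackStalkIso jB F (jU u)).toLinearEquiv ≪≫ₗ
    (pullbackStalkIso jU (restrict F B) u).toLinearEquiv).symm

/-- A sheaf with unique sections along an open subset `U` of `A` is constant on `U`. -/
lemma HasUniqueSections.exists_iso_constantSheaf {F : TopCat.Sheaf (ModuleCat.{u} k) X} {A : Set X}
    {U : Set A} (h : HasUniqueSections F.presheaf fun u : U => ((u : A) : X)) (u₀ : U)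
    [Module.Finite k (F.presheaf.stalk ((u₀ : A) : X))] :
    ∃ M : ModuleCat.{u} k, Module.Finite k M ∧
      Nonempty (restrict (restrict F A) U ≅
        (constantSheaf (Opens.grothendieckTopology (TopCat.of U)) (ModuleCat.{u} k)).obj M) := by
  let jA : TopCat.of A ⟶ X := TopCat.ofHom ⟨Subtype.val, continuous_subtype_val⟩
  let jU : TopCat.of U ⟶ TopCat.of A := TopCat.ofHom ⟨Subtype.val, continuous_subtype_val⟩
  let H := restrict (restrict F A) U
  let φ : ∀ u : U, F.presheaf.stalk ((u : A) : X) ≃ₗ[k] H.presheaf.stalk u := fun u =>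
    (pullbackStalkIso jA F (jU u)).toLinearEquiv ≪≫ₗ
      (pullbackStalkIso jU (restrict F A) u).toLinearEquiv
  have hφ : ∀ (σ : ∀ u : U, F.presheaf.stalk ((u : A) : X)) (u : U),
      IsSectionAt H.presheaf (fun u : U => u) (fun u => φ u (σ u)) u ↔
        IsSectionAt F.presheaf (fun u : U => ((u : A) : X)) σ u := by
    intro σ u
    exact (isSectionAt_pullback_iff jU (restrict F A) (g := fun u : U => u) continuousAt_id _).trans
      (isSectionAt_pullback_iff jA F (g := fun u : U => (u : A))
        continuous_subtype_val.continuousAt σ)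
  -- Uniqueness of sections gives injectivity of the germ map; existence, glued by the sheaf axiom,
  -- gives surjectivity.
  have hbij : ∀ u : U, Function.Bijective (H.presheaf.germ ⊤ u (Opens.mem_top _)) := by
    intro u
    constructor
    · intro s s' hs
      obtain ⟨σ₀, -, hσ₀⟩ := h u ((φ u).symm (H.presheaf.germ ⊤ u (Opens.mem_top _) s))
      have key : ∀ s₁ : H.presheaf.obj (op ⊤), H.presheaf.germ ⊤ u (Opens.mem_top _) s₁ =
          H.presheaf.germ ⊤ u (Opens.mem_top _) s →
          (fun t : U => (φ t).symm (H.presheaf.germ ⊤ t (Opens.mem_top _) s₁)) = σ₀ := by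
        intro s₁ hs₁
        refine hσ₀ _ ⟨fun t => ?_, congrArg (φ u).symm hs₁⟩
        rw [← hφ]
        refine ⟨⊤, s₁, Eventually.of_forall fun t => ⟨Opens.mem_top _, ?_⟩⟩
        exact (φ t).apply_symm_apply _
      refine TopCat.Presheaf.section_ext H _ _ _ fun t ht => ?_
      exact (φ t).symm.injective (congrFun ((key s rfl).trans (key s' hs.symm).symm) t)
    · intro e
      obtain ⟨σ, ⟨h1, h2⟩, -⟩ := h u ((φ u).symm e)
      obtain ⟨s, hs⟩ := exists_global_section H (fun t => φ t (σ t)) fun t => (hφ σ t).2 (h1 t)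
      refine ⟨s, (hs u).trans ?_⟩
      rw [h2]
      exact (φ u).apply_symm_apply e
  refine ⟨H.presheaf.obj (op ⊤), ?_, nonempty_iso_constantSheaf H hbij⟩
  exact Module.Finite.equiv ((φ u₀).trans (LinearEquiv.ofBijective
    (H.presheaf.germ ⊤ u₀ (Opens.mem_top _)).hom (hbij u₀)).symm)

end LocallyConstant

/-! ### Constructibility along flat strata. -/

section Constructible

open Filter Topology

variable {V : Type u} [NormedAddCommGroup V] [InnerProductSpace ℝ V]
  {W : Subgroup (V ≃ₗᵢ[ℝ] V)} {k : Type u} [Field k]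
  {F : TopCat.Sheaf (ModuleCat.{u} k) (TopCat.of (ComplexQuotient W))}

lemma IsConstructible.isTrivialAt_path {S : Set (Set (ComplexQuotient W))}
    (h : IsConstructible S F) {B : Set (ComplexQuotient W)} (hB : B ∈ S)
    {γ : unitInterval → ComplexQuotient W} (hγ : Continuous γ) (hmem : ∀ t, γ t ∈ B)
    (t : unitInterval) : IsTrivialAt F.presheaf γ t := by
  have h1 := (h B hB).isTrivialAt ⟨γ t, hmem t⟩
  have h2 : Continuous fun t => (⟨γ t, hmem t⟩ : B) := hγ.subtype_mk _
  exact h1.comp (g := fun t => (⟨γ t, hmem t⟩ : B)) h2.continuousAt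
    (Eventually.of_forall fun t => h2.continuousAt)

variable {z₀ : Complexified V} {ε : ℝ}

/-- The box is swept out from z₀ in two stages: horizontally at the height of z₀, inside one cell,
then vertically, each path inside one τ-cell. Unique sections for the constant map at z₀ pass
through both stages. -/
lemma IsSmall.hasUniqueSections (hε : IsSmall W z₀ ε)
    (h1 : IsConstructible (family W (cellClass W)) F)
    (h2 : IsConstructible (family W (swapClass (cellClass W))) F) :
    HasUniqueSections F.presheaf fun z : box W z₀ ε => proj W z := by
  have : PreconnectedSpace (box W z₀ ε) :=
    Subtype.preconnectedSpace convex_box.isPreconnected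
  have hseg : ∀ z z' : Complexified V, z ∈ box W z₀ ε → z' ∈ box W z₀ ε → ∀ t : unitInterval,
      z + (t : ℝ) • (z' - z) ∈ box W z₀ ε := fun z z' hz hz' t =>
    convex_box.add_smul_sub_mem hz hz' t.2
  have h0 := hε.center_mem_box
  let f₁ : box W z₀ ε × unitInterval → ComplexQuotient W := fun p =>
    proj W (z₀.1 + (p.2 : ℝ) • (p.1.1.1 - z₀.1), z₀.2)
  let f₂ : box W z₀ ε × unitInterval → ComplexQuotient W := fun p =>
    proj W (p.1.1.1, z₀.2 + (p.2 : ℝ) • (p.1.1.2 - z₀.2))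
  have hf₁ : Continuous f₁ := continuous_proj.comp (by fun_prop)
  have hf₂ : Continuous f₂ := continuous_proj.comp (by fun_prop)
  have ht₁ : ∀ a t, IsTrivialAt F.presheaf (fun t => f₁ (a, t)) t := fun a =>
    h1.isTrivialAt_path (B := proj W '' cellClass W z₀) ⟨z₀, rfl⟩ (by fun_prop) fun t =>
      ⟨_, hε.mem_cellClass (mk_mem_box (hseg z₀ a h0 a.2 t) h0), rfl⟩
  have ht₂ : ∀ a t, IsTrivialAt F.presheaf (fun t => f₂ (a, t)) t := fun a =>
    h2.isTrivialAt_path (B := proj W '' swapClass (cellClass W) a) ⟨a, rfl⟩ (by fun_prop)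
      fun t => ⟨_, hε.mem_swapClass a.2 (mk_mem_box a.2 (hseg z₀ a h0 a.2 t)), rfl⟩
  have e₁ : (fun a => f₁ (a, 0)) = fun _ => proj W z₀ := by
    funext a
    simp [f₁]
  have e₂ : (fun a => f₂ (a, 0)) = fun a => f₁ (a, 1) := by
    funext a
    simp [f₁, f₂]
  have e₃ : (fun z : box W z₀ ε => proj W z) = fun a => f₂ (a, 1) := by
    funext a
    simp [f₂]
  rw [e₃]
  refine hasUniqueSections_of_paths hf₂ ht₂ ?_
  rw [e₂]
  refine hasUniqueSections_of_paths hf₁ ht₁ ?_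
  rw [e₁]
  exact hasUniqueSections_const _

/-- Small boxes are open charts of the stratum on which F has unique sections; the rank is finite
because the stalk at the centre is also a stalk along a cell. -/
lemma isConstructible_flatClass [FiniteDimensional ℝ V] (hW : IsFiniteReflectionGroup W)
    (h1 : IsConstructible (family W (cellClass W)) F)
    (h2 : IsConstructible (family W (swapClass (cellClass W))) F) :
    IsConstructible (family W (flatClass W)) F := by
  intro A hA a
  obtain ⟨z₀, hz₀⟩ := proj_surjective (W := W) a.1
  obtain rfl := isClassMap_flatClass.eq_image hA (z := z₀) (by rw [hz₀]; exact a.2)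
  obtain ⟨ε, hε⟩ := exists_isSmall hW.1 z₀
  have hj := hε.isOpenEmbedding hW
  let ρ := hj.toIsEmbedding.toHomeomorph
  let b : box W z₀ ε := ⟨z₀, hε.center_mem_box⟩
  have hu := HasUniqueSections.of_homeomorph (F := F.presheaf) ρ
    (f := fun u => ((u : proj W '' flatClass W z₀) : ComplexQuotient W))
    (hε.hasUniqueSections h1 h2)
  have hfin : Module.Finite k (F.presheaf.stalk ((ρ b : proj W '' flatClass W z₀) :
      ComplexQuotient W)) :=
    (h1 _ ⟨z₀, rfl⟩).finite_stalk ⟨proj W z₀, isClassMap_cellClass.proj_mem z₀⟩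
  exact ⟨_, hj.isOpen_range, ⟨b, Subtype.ext hz₀⟩, hu.exists_iso_constantSheaf (ρ b)⟩

end Constructible

end FoxNeuwirthFuchs

theorem mainTheorem2 {V : Type u} [NormedAddCommGroup V] [InnerProductSpace ℝ V]
    [FiniteDimensional ℝ V] (W : Subgroup (V ≃ₗᵢ[ℝ] V))
    (hW : FoxNeuwirthFuchs.IsFiniteReflectionGroup W)
    (Cplus : Set V) (hCplus : FoxNeuwirthFuchs.IsChamber W Cplus) :
    (FoxNeuwirthFuchs.IsFinitePartition (FoxNeuwirthFuchs.SIm W Cplus) ∧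
      FoxNeuwirthFuchs.IsFinitePartition (FoxNeuwirthFuchs.S1 W) ∧
      FoxNeuwirthFuchs.IsFinitePartition (FoxNeuwirthFuchs.S0 W)) ∧
    (FoxNeuwirthFuchs.S1 W =
        FoxNeuwirthFuchs.wedge (FoxNeuwirthFuchs.SIm W Cplus) (FoxNeuwirthFuchs.S0 W) ∧
      FoxNeuwirthFuchs.Refines (FoxNeuwirthFuchs.S1 W) (FoxNeuwirthFuchs.SIm W Cplus) ∧
      FoxNeuwirthFuchs.Refines (FoxNeuwirthFuchs.S1 W) (FoxNeuwirthFuchs.S0 W)) ∧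
    (FoxNeuwirthFuchs.S0 W =
        FoxNeuwirthFuchs.vee (FoxNeuwirthFuchs.S1 W)
          (FoxNeuwirthFuchs.imageFamily (FoxNeuwirthFuchs.tau W) (FoxNeuwirthFuchs.S1 W)) ∧
      ∀ (k : Type u) [Field k]
        (F : TopCat.Sheaf (ModuleCat.{u} k)
          (TopCat.of (FoxNeuwirthFuchs.ComplexQuotient W))),
        FoxNeuwirthFuchs.IsConstructible (FoxNeuwirthFuchs.S1 W) F →
        FoxNeuwirthFuchs.IsConstructible
          (FoxNeuwirthFuchs.imageFamily (FoxNeuwirthFuchs.tau W)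
            (FoxNeuwirthFuchs.S1 W)) F →
        FoxNeuwirthFuchs.IsConstructible (FoxNeuwirthFuchs.S0 W) F) := by
  
  have hfin := hW.1
  have hcell := FoxNeuwirthFuchs.isClassMap_cellClass (W := W)
  have hflat := FoxNeuwirthFuchs.isClassMap_flatClass (W := W)
  have him := FoxNeuwirthFuchs.isClassMap_imClass (W := W)
  rw [FoxNeuwirthFuchs.SIm_eq_family hfin hCplus, FoxNeuwirthFuchs.S1_eq_family hfin,
    FoxNeuwirthFuchs.S0_eq_family hfin, FoxNeuwirthFuchs.imageFamily_tau]
  exact ⟨⟨him.isFinitePartition hfin, hcell.isFinitePartition hfin, hflat.isFinitePartition hfin⟩,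
    ⟨FoxNeuwirthFuchs.family_cellClass_eq_wedge hfin,
      hcell.refines him FoxNeuwirthFuchs.cellClass_subset_imClass,
      hcell.refines hflat FoxNeuwirthFuchs.cellClass_subset_flatClass⟩,
    FoxNeuwirthFuchs.family_flatClass_eq_vee hfin,
    fun k _ F h1 h2 => FoxNeuwirthFuchs.isConstructible_flatClass hW h1 h2⟩
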